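/- Let $(M,g)$ be a smooth Riemannian manifold and let $(E,\langle\cdot,\cdot\rangle,\nabla)$ be a smooth real or complex vector bundle of finite rank over $M$ with a smooth fibre metric $\langle\cdot,\cdot\rangle$ (Euclidean in the real case, Hermitian in the complex case) and a smooth metric-compatible connection $\nabla$ (complex-linear in the complex case). For every compact subset $K\subset M$ there exists a constant $C_K>0$ with the following property. If $\alpha\colon S^1\to M$ is a smooth map with $\alpha(S^1)\subset K$ and $\xi,\zeta$ are smooth sections of $\alpha^*E$, then $$\bigg|\int_0^{2\pi}\langle\nabla_\theta\xi,\zeta\rangle\,d\theta\bigg|\le \|\nabla_\theta\xi\|_2\,\|\nabla_\theta\zeta\|_2+C_K\,\min\big(\|d\alpha\|_1,\|d\alpha\|_2^2\big)\,\|\xi\|_{2,1}\,\|\zeta\|_2 .$$ Here $S^1$ is the unit circle with coordinate $e^{i\theta}$ and its standard metric, $\nabla_\theta=(\alpha^*\nabla)_{\partial_\theta}$ is the covariant derivative of the pullback connection along the oriented unit vector field $\partial_\theta$, $\|\eta\|_2=\big(\int_0^{2\pi}|\eta|^2\,d\theta\big)^{1/2}$ for a section $\eta$ of $\alpha^*E$,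 $\|\xi\|_{2,1}=\|\xi\|_2+\|\nabla_\theta\xi\|_2$, and $\|d\alpha\|_p=\big(\int_0^{2\pi}|\alpha'(\theta)|_g^p\,d\theta\big)^{1/p}$ for $p=1,2$. -/

import Mathlib

open Bundle
open scoped Manifold ContDiff

noncomputable section

namespace LoopBundle

section Defs

variable {EM : Type*} [NormedAddCommGroup EM] [NormedSpace ℝ EM]
  {HM : Type*} [TopologicalSpace HM] {I : ModelWithCorners ℝ EM HM}
  {M : Type*} [TopologicalSpace M] [ChartedSpace HM M]
  {F : Type*} [NormedAddCommGroup F] [NormedSpace ℝ F]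
  {E : M → Type*} [TopologicalSpace (TotalSpace F E)]
  [∀ x, NormedAddCommGroup (E x)] [∀ x, InnerProductSpace ℝ (E x)]
  [FiberBundle F E] [VectorBundle ℝ F E]

variable (I) in
/-- The velocity `γ'(t)` of a curve `γ` in `M`. -/
def velocity (γ : ℝ → M) (t : ℝ) : TangentSpace I (γ t) :=
  mfderiv 𝓘(ℝ, ℝ) I γ t (1 : ℝ)

/-- The covariant derivative `(D/dt) ξ` of a section `ξ` of `E` along a curve `γ`, i.e. the
pullback connection `∇^γ` applied to `ξ` in the direction `∂_t`.

In the trivialization `e` of `E` around `γ t` write `ξ = e⁻¹ f` and let `w = f t`. The connection is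
`d + θ` in this trivialization, where `e⁻¹ (θ(v) w) = ∇_v (e⁻¹ w)` is the covariant derivative of the
local section with constant coordinates `w`. Hence
`(D/dt) ξ = e⁻¹ (f' + θ(γ') w) = e⁻¹ f' + ∇_{γ'} (e⁻¹ w)`. -/
def covDerivAlong (cov : CovariantDerivative I F E) (γ : ℝ → M) (ξ : ∀ t, E (γ t)) (t : ℝ) :
    E (γ t) :=
  let e := trivializationAt F E (γ t)
  let f : ℝ → F := fun s => (e ⟨γ s, ξ s⟩).2
  e.symm (γ t) (deriv f t) + cov (fun x => e.symm x (f t)) (γ t) (velocity I γ t)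

variable (I F) in
/-- Smoothness of a section `ξ` of `α^* E` for a loop `α : S¹ → M`: smoothness as a map
`S¹ → E` covering `α`. -/
def IsSmoothSectionAlong (α : Circle → M) (ξ : ∀ z, E (α z)) : Prop :=
  ContMDiff (𝓡 1) (I.prod 𝓘(ℝ, F)) ∞ (fun z => TotalSpace.mk' F (α z) (ξ z))

/-- `∇_θ ξ` at the point `e^{iθ}` of the circle, for a section `ξ` along a loop `α`: the covariant
derivative with respect to the oriented unit field `∂_θ` on `S¹`. -/
def covDerivLoop (cov : CovariantDerivative I F E) (α : Circle → M) (ξ : ∀ z, E (α z)) (θ : ℝ) :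
    E (α (Circle.exp θ)) :=
  covDerivAlong cov (fun t => α (Circle.exp t)) (fun t => ξ (Circle.exp t)) θ

/-- `‖ξ‖₂` for a section `ξ` along a loop `α`, with respect to `dθ` on `S¹`. The section is written
as a function of the angle `θ`. -/
def normL2 (α : Circle → M) (ξ : ∀ θ : ℝ, E (α (Circle.exp θ))) : ℝ :=
  √(∫ θ in (0 : ℝ)..(2 * Real.pi), ‖ξ θ‖ ^ 2)

/-- `‖ξ‖_{2,1} = ‖ξ‖₂ + ‖∇_θ ξ‖₂` for a section `ξ` along a loop `α`. -/
def normW21 (cov : CovariantDerivative I F E) (α : Circle → M) (ξ : ∀ z, E (α z)) : ℝ :=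
  normL2 α (fun θ => ξ (Circle.exp θ)) + normL2 α (covDerivLoop cov α ξ)

section Loop

variable [RiemannianBundle (fun x : M => TangentSpace I x)]

variable (I) in
/-- `‖dα‖₁ = ∫ |dα/dθ| dθ`. -/
def speedL1 (α : Circle → M) : ℝ :=
  ∫ θ in (0 : ℝ)..(2 * Real.pi), ‖velocity I (fun t => α (Circle.exp t)) θ‖

variable (I) in
/-- `‖dα‖₂ = (∫ |dα/dθ|² dθ)^{1/2}`. -/
def speedL2 (α : Circle → M) : ℝ :=
  √(∫ θ in (0 : ℝ)..(2 * Real.pi), ‖velocity I (fun t => α (Circle.exp t)) θ‖ ^ 2)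

end Loop

/-- The data making a real Euclidean bundle with connection `(E, ⟨,⟩, ∇)` a Hermitian complex vector
bundle with complex-linear connection: a smooth complex structure `J` on the fibres that is
orthogonal and parallel. -/
structure HermitianStructure (cov : CovariantDerivative I F E) where
  /-- multiplication by `i` on the fibres -/
  J : ∀ x, E x →L[ℝ] E x
  smooth : ContMDiff I (I.prod 𝓘(ℝ, F →L[ℝ] F)) ∞
    (fun x => TotalSpace.mk' (F →L[ℝ] F) (E := fun x => E x →L[ℝ] E x) x (J x))
  sq : ∀ x (v : E x), J x (J x v) = -v
  orthogonal : ∀ x (v w : E x), inner ℝ (J x v) (J x w) = inner ℝ v w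
  parallel : ∀ (σ : ∀ x, E x) (x : M),
    MDifferentiableAt I (I.prod 𝓘(ℝ, F)) (fun y => TotalSpace.mk' F y (σ y)) x →
    ∀ v : TangentSpace I x, cov (fun y => J y (σ y)) x v = J x (cov σ x v)

/-- The Hermitian inner product with real part `⟨v, w⟩`; it is complex linear in `v` and conjugate
linear in `w`. -/
def HermitianStructure.herm {cov : CovariantDerivative I F E} (S : HermitianStructure cov)
    (x : M) (v w : E x) : ℂ :=
  ⟨inner ℝ v w, inner ℝ v (S.J x w)⟩

end Defs

end LoopBundle

end

/-! For honestly periodic vector functions x, y on [0, 2π] the inequality holds without an error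
term. The integral of ⟨x', y⟩ does not change when the mean of y is subtracted, so Cauchy–Schwarz
and Wirtinger's inequality bound it by ‖x'‖₂ ‖y'‖₂. A section along a loop becomes such a function
in a parallel orthonormal frame, except that the frame need not close up. Coordinates are then
periodic only up to the holonomy, an isometry G of Euclidean space.

If |G v - v| ≤ ε|v|, then y can be corrected by terms of size ε to a periodic function z, to which
Wirtinger applies. The mean c of z now contributes ⟨x(2π) - x(0), c⟩, at most ε |x(2π)| |c|. The
endpoint value is controlled by ‖x‖₂ + ‖x'‖₂, which is where ‖ξ‖_{2,1} enters. This is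
`twisted_inequality`.

The geometric input is ε = O(ℓ²), with ℓ the length of the loop (`norm_holonomy_sub_le`). To first
order the holonomy is the integral of the connection form frozen at the base point, and this
vanishes on a closed curve. What remains is quadratic in ℓ, with a constant depending only on bounds
and Lipschitz constants of the connection form in a chart. A short loop starting near p stays in one
such chart (`exists_stay`), and compactness of K makes the constants uniform
(`short_loop_inequality`).

For short loops ℓ² is bounded by a multiple of ℓ, and also by 2π‖dα‖₂², hence by a multiple of the
minimum. For long loops the minimum is bounded below, and Cauchy–Schwarz alone suffices
(`loop_inequality`). The Hermitian case reduces to the real one: the modulus of the complex integral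
is the real integral for ζ multiplied by a unit complex number, which changes neither ‖ζ‖₂ nor
‖∇ζ‖₂. -/

noncomputable section

namespace LoopBundle

open Set MeasureTheory intervalIntegral Filter
open scoped Topology

/-! ### L² estimates on [0, 2π] and Wirtinger's inequality -/

section Analysis

/-- The `L²` norm on `[0, 2π]`. -/
def l2 {V : Type*} [NormedAddCommGroup V] (f : ℝ → V) : ℝ :=
  √(∫ θ in (0 : ℝ)..(2 * Real.pi), ‖f θ‖ ^ 2)

lemma l2_nonneg {V : Type*} [NormedAddCommGroup V] (f : ℝ → V) : 0 ≤ l2 f := Real.sqrt_nonneg _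

lemma sq_l2 {V : Type*} [NormedAddCommGroup V] (f : ℝ → V) :
    l2 f ^ 2 = ∫ θ in (0 : ℝ)..(2 * Real.pi), ‖f θ‖ ^ 2 :=
  Real.sq_sqrt (integral_nonneg Real.two_pi_pos.le fun _ _ => by positivity)

/-- Cauchy–Schwarz for the norms of two functions. -/
lemma integral_norm_mul_norm_le {V W : Type*} [NormedAddCommGroup V] [NormedAddCommGroup W]
    {f : ℝ → V} {g : ℝ → W}
    (hf : ContinuousOn f (Icc 0 (2 * Real.pi))) (hg : ContinuousOn g (Icc 0 (2 * Real.pi))) :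
    ∫ t in (0 : ℝ)..(2 * Real.pi), ‖f t‖ * ‖g t‖ ≤ l2 f * l2 g := by
  have hT := Real.two_pi_pos.le
  -- The integral of (‖f‖ - r‖g‖)² is a nonnegative quadratic polynomial in r; its discriminant
  -- gives the claim.
  have key : ∀ r : ℝ, 0 ≤ l2 g ^ 2 * (r * r) +
      (-2 * ∫ t in (0 : ℝ)..(2 * Real.pi), ‖f t‖ * ‖g t‖) * r + l2 f ^ 2 := by
    intro r
    have hi1 : IntervalIntegrable (fun t => ‖g t‖ ^ 2) volume 0 (2 * Real.pi) :=
      (hg.norm.pow 2).intervalIntegrable_of_Icc hT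
    have hi2 : IntervalIntegrable (fun t => ‖f t‖ ^ 2) volume 0 (2 * Real.pi) :=
      (hf.norm.pow 2).intervalIntegrable_of_Icc hT
    have hi3 : IntervalIntegrable (fun t => ‖f t‖ * ‖g t‖) volume 0 (2 * Real.pi) :=
      (hf.norm.mul hg.norm).intervalIntegrable_of_Icc hT
    have : 0 ≤ ∫ t in (0 : ℝ)..(2 * Real.pi), (‖f t‖ - r * ‖g t‖) ^ 2 :=
      integral_nonneg hT fun _ _ => by positivity
    refine this.trans_eq ?_
    rw [sq_l2, sq_l2]
    have e : ∀ t, (‖f t‖ - r * ‖g t‖) ^ 2 =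
        (r * r) * ‖g t‖ ^ 2 + (-2 * r) * (‖f t‖ * ‖g t‖) + ‖f t‖ ^ 2 := fun t => by ring
    simp_rw [e]
    rw [integral_add ((hi1.const_mul _).add (hi3.const_mul _)) hi2,
      integral_add (hi1.const_mul _) (hi3.const_mul _), intervalIntegral.integral_const_mul,
      intervalIntegral.integral_const_mul]
    ring
  have hd := discrim_le_zero key
  rw [discrim] at hd
  refine abs_le_of_sq_le_sq' ?_ (mul_nonneg (l2_nonneg f) (l2_nonneg g)) |>.2
  nlinarith

lemma integral_norm_le_l2 {V : Type*} [NormedAddCommGroup V] {f : ℝ → V}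
    (hf : ContinuousOn f (Icc 0 (2 * Real.pi))) :
    ∫ t in (0 : ℝ)..(2 * Real.pi), ‖f t‖ ≤ √(2 * Real.pi) * l2 f := by
  have h := integral_norm_mul_norm_le (f := fun _ => (1 : ℝ)) continuousOn_const hf
  simpa [l2] using h

/-- Minkowski's inequality for the scalar functions ‖f‖ and a‖g‖, so the three functions may take
values in different spaces. -/
lemma l2_le_add {V W Z : Type*} [NormedAddCommGroup V] [NormedAddCommGroup W]
    [NormedAddCommGroup Z] {f : ℝ → V} {g : ℝ → W} {h : ℝ → Z}
    (hf : ContinuousOn f (Icc 0 (2 * Real.pi))) (hg : ContinuousOn g (Icc 0 (2 * Real.pi)))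
    (hh : ContinuousOn h (Icc 0 (2 * Real.pi))) {a : ℝ} (ha : 0 ≤ a)
    (hle : ∀ t ∈ Icc 0 (2 * Real.pi), ‖h t‖ ≤ ‖f t‖ + a * ‖g t‖) :
    l2 h ≤ l2 f + a * l2 g := by
  have hT := Real.two_pi_pos.le
  have hi1 : IntervalIntegrable (fun t => ‖g t‖ ^ 2) volume 0 (2 * Real.pi) :=
    (hg.norm.pow 2).intervalIntegrable_of_Icc hT
  have hi2 : IntervalIntegrable (fun t => ‖f t‖ ^ 2) volume 0 (2 * Real.pi) :=
    (hf.norm.pow 2).intervalIntegrable_of_Icc hT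
  have hi3 : IntervalIntegrable (fun t => ‖f t‖ * ‖g t‖) volume 0 (2 * Real.pi) :=
    (hf.norm.mul hg.norm).intervalIntegrable_of_Icc hT
  have hi4 : IntervalIntegrable (fun t => ‖h t‖ ^ 2) volume 0 (2 * Real.pi) :=
    (hh.norm.pow 2).intervalIntegrable_of_Icc hT
  have hnn : 0 ≤ l2 f + a * l2 g := add_nonneg (l2_nonneg f) (mul_nonneg ha (l2_nonneg g))
  refine abs_le_of_sq_le_sq' ?_ hnn |>.2
  have h1 : l2 h ^ 2 ≤ ∫ t in (0 : ℝ)..(2 * Real.pi),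
      (‖f t‖ ^ 2 + (2 * a) * (‖f t‖ * ‖g t‖) + a ^ 2 * ‖g t‖ ^ 2) := by
    rw [sq_l2]
    refine integral_mono_on hT hi4 ((hi2.add (hi3.const_mul _)).add (hi1.const_mul _))
      fun t ht => ?_
    calc ‖h t‖ ^ 2 ≤ (‖f t‖ + a * ‖g t‖) ^ 2 := pow_le_pow_left₀ (norm_nonneg _) (hle t ht) 2
      _ = _ := by ring
  rw [integral_add (hi2.add (hi3.const_mul _)) (hi1.const_mul _),
    integral_add hi2 (hi3.const_mul _), intervalIntegral.integral_const_mul,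
    intervalIntegral.integral_const_mul, ← sq_l2, ← sq_l2] at h1
  have h2 := mul_le_mul_of_nonneg_left (integral_norm_mul_norm_le hf hg)
    (by positivity : 0 ≤ 2 * a)
  nlinarith

/-- Wirtinger's inequality for real functions. -/
lemma wirtinger_real {f f' : ℝ → ℝ} (hf : ∀ t ∈ Icc 0 (2 * Real.pi), HasDerivAt f (f' t) t)
    (hf' : ContinuousOn f' (Icc 0 (2 * Real.pi))) (hper : f (2 * Real.pi) = f 0)
    (hmean : ∫ t in (0 : ℝ)..(2 * Real.pi), f t = 0) :
    ∫ t in (0 : ℝ)..(2 * Real.pi), f t ^ 2 ≤ ∫ t in (0 : ℝ)..(2 * Real.pi), f' t ^ 2 := by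
  have hT := Real.two_pi_pos
  have hfc : ContinuousOn f (Icc 0 (2 * Real.pi)) := fun t ht =>
    (hf t ht).continuousAt.continuousWithinAt
  have hmem : ∀ g : ℝ → ℝ, ContinuousOn g (Icc 0 (2 * Real.pi)) →
      MemLp (fun t => (g t : ℂ)) 2 (volume.restrict (Ioc 0 (2 * Real.pi))) := by
    intro g hg
    have hg2 : ContinuousOn (fun t => (g t : ℂ)) (Icc 0 (2 * Real.pi)) :=
      Complex.continuous_ofReal.comp_continuousOn hg
    obtain ⟨C, hC⟩ := isCompact_Icc.exists_bound_of_continuousOn hg2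
    refine MemLp.of_bound
      ((hg2.mono Ioc_subset_Icc_self).aestronglyMeasurable measurableSet_Ioc) C ?_
    exact (ae_restrict_mem measurableSet_Ioc).mono fun t ht => hC t (Ioc_subset_Icc_self ht)
  have h1 := hasSum_sq_fourierCoeffOn hT (hmem f hfc)
  have h2 := hasSum_sq_fourierCoeffOn hT (hmem f' hf')
  -- Parseval reduces the claim to single coefficients. The one at n = 0 vanishes by the mean
  -- condition. For n ≠ 0 periodicity removes the boundary term, and the coefficient of f is that of
  -- f' divided by in.
  have hle : ∀ n : ℤ, ‖fourierCoeffOn hT (fun t => (f t : ℂ)) n‖ ^ 2 ≤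
      ‖fourierCoeffOn hT (fun t => (f' t : ℂ)) n‖ ^ 2 := by
    intro n
    by_cases hn : n = 0
    · have : fourierCoeffOn hT (fun t => (f t : ℂ)) n = 0 := by
        rw [fourierCoeffOn_eq_integral, hn]
        have : ∫ t in (0 : ℝ)..(2 * Real.pi), (f t : ℂ) = 0 := by
          rw [intervalIntegral.integral_ofReal, hmean]; simp
        simp [this]
      rw [this]; simp
    · rw [fourierCoeffOn_of_hasDerivAt hT hn (f' := fun t => (f' t : ℂ))
        (fun t ht => (hf t (by rwa [uIcc_of_le hT.le] at ht)).ofReal_comp)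
        ((Complex.continuous_ofReal.comp_continuousOn hf').intervalIntegrable_of_Icc hT.le)]
      · rw [hper]
        refine pow_le_pow_left₀ (norm_nonneg _) ?_ 2
        have hn1 : (1 : ℝ) ≤ |(n : ℝ)| := by
          exact_mod_cast Int.one_le_abs hn
        have hpi := Real.pi_pos
        simp only [sub_self, mul_zero, zero_sub, norm_mul, norm_div, norm_neg, norm_one,
          Complex.norm_I, Complex.norm_intCast, Complex.norm_real, Complex.norm_two]
        simp only [Complex.ofReal_zero, sub_zero, Complex.norm_real,
          Real.norm_eq_abs, abs_of_pos hT, abs_of_pos hpi]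
        rw [← mul_assoc]
        refine mul_le_of_le_one_left (norm_nonneg _) ?_
        rw [div_mul_eq_mul_div, one_mul, div_le_one (by positivity)]
        nlinarith
  have h3 := hasSum_le hle h1 h2
  simp only [Complex.norm_real, Real.norm_eq_abs, sq_abs, smul_eq_mul] at h3
  exact le_of_mul_le_mul_left h3 (by simpa using hT)

lemma wirtinger {ι : Type*} [Fintype ι] {f f' : ℝ → EuclideanSpace ℝ ι}
    (hf : ∀ t ∈ Icc 0 (2 * Real.pi), HasDerivAt f (f' t) t)
    (hf' : ContinuousOn f' (Icc 0 (2 * Real.pi))) (hper : f (2 * Real.pi) = f 0)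
    (hmean : ∫ t in (0 : ℝ)..(2 * Real.pi), f t = 0) : l2 f ≤ l2 f' := by
  have hT := Real.two_pi_pos.le
  have hfc : ContinuousOn f (Icc 0 (2 * Real.pi)) := fun t ht =>
    (hf t ht).continuousAt.continuousWithinAt
  have hpr : ∀ {g : ℝ → EuclideanSpace ℝ ι}, ContinuousOn g (Icc 0 (2 * Real.pi)) →
      ∀ i, ContinuousOn (fun t => g t i) (Icc 0 (2 * Real.pi)) := fun hg i =>
    (EuclideanSpace.proj (𝕜 := ℝ) i).continuous.comp_continuousOn hg
  refine Real.sqrt_le_sqrt ?_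
  simp_rw [EuclideanSpace.norm_sq_eq, Real.norm_eq_abs, sq_abs]
  have hint : ∀ {g : ℝ → EuclideanSpace ℝ ι}, ContinuousOn g (Icc 0 (2 * Real.pi)) → ∀ i,
      IntervalIntegrable (fun t => g t i ^ 2) volume 0 (2 * Real.pi) := fun hg i =>
    ((hpr hg i).pow 2).intervalIntegrable_of_Icc hT
  rw [intervalIntegral.integral_finsetSum fun i _ => hint hfc i,
    intervalIntegral.integral_finsetSum fun i _ => hint hf' i]
  refine Finset.sum_le_sum fun i _ => wirtinger_real (fun t ht => ?_) (hpr hf' i) ?_ ?_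
  · exact (EuclideanSpace.proj (𝕜 := ℝ) i).hasFDerivAt.comp_hasDerivAt t (hf t ht)
  · rw [hper]
  · have := (EuclideanSpace.proj (𝕜 := ℝ) i).intervalIntegral_comp_comm
      (hfc.intervalIntegrable_of_Icc (μ := volume) hT)
    rw [hmean] at this
    simpa using this

end Analysis

/-! ### The inequality for functions periodic up to an isometry -/

section Twisted

variable {ι : Type*} [Fintype ι]

/-- Integrating (t x)' = x + t x' over [0, 2π] leaves only the value at the right endpoint. -/
lemma norm_endpoint_le {x x' : ℝ → EuclideanSpace ℝ ι}
    (hx : ∀ t ∈ Icc 0 (2 * Real.pi), HasDerivAt x (x' t) t)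
    (hx' : ContinuousOn x' (Icc 0 (2 * Real.pi))) :
    √(2 * Real.pi) * ‖x (2 * Real.pi)‖ ≤ l2 x + 2 * Real.pi * l2 x' := by
  have hT := Real.two_pi_pos
  have hxc : ContinuousOn x (Icc 0 (2 * Real.pi)) := fun t ht =>
    (hx t ht).continuousAt.continuousWithinAt
  have hd : ContinuousOn (fun t => x t + t • x' t) (Icc 0 (2 * Real.pi)) :=
    hxc.add (continuousOn_id.smul hx')
  have h1 : ∫ t in (0 : ℝ)..(2 * Real.pi), (x t + t • x' t) = (2 * Real.pi) • x (2 * Real.pi) := by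
    rw [integral_eq_sub_of_hasDerivAt (f := fun t => t • x t) (fun t ht => ?_)
      (hd.intervalIntegrable_of_Icc hT.le)]
    · simp
    · rw [uIcc_of_le hT.le] at ht
      have h := (hasDerivAt_id' t).fun_smul (hx t ht)
      rwa [one_smul, add_comm] at h
  have h2 : 2 * Real.pi * ‖x (2 * Real.pi)‖ ≤ ∫ t in (0 : ℝ)..(2 * Real.pi), ‖x t + t • x' t‖ := by
    have := norm_integral_le_integral_norm (f := fun t => x t + t • x' t) (μ := volume) hT.le
    rwa [h1, norm_smul, Real.norm_of_nonneg hT.le] at this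
  have h3 : l2 (fun t => x t + t • x' t) ≤ l2 x + 2 * Real.pi * l2 x' :=
    l2_le_add hxc hx' hd hT.le fun t ht => (norm_add_le _ _).trans <| by
      rw [norm_smul, Real.norm_of_nonneg ht.1]
      gcongr
      exact ht.2
  have h4 := h2.trans ((integral_norm_le_l2 hd).trans
    (mul_le_mul_of_nonneg_left h3 (Real.sqrt_nonneg _)))
  have h5 : 0 < √(2 * Real.pi) := Real.sqrt_pos.2 hT
  refine le_of_mul_le_mul_left ?_ h5
  rwa [← mul_assoc, Real.mul_self_sqrt hT.le]

/-- The isoperimetric inequality for functions which are periodic up to an isometry close to the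
identity. -/
lemma twisted_inequality {x x' y y' : ℝ → EuclideanSpace ℝ ι}
    (hx : ∀ t ∈ Icc 0 (2 * Real.pi), HasDerivAt x (x' t) t)
    (hx' : ContinuousOn x' (Icc 0 (2 * Real.pi)))
    (hy : ∀ t ∈ Icc 0 (2 * Real.pi), HasDerivAt y (y' t) t)
    (hy' : ContinuousOn y' (Icc 0 (2 * Real.pi)))
    (G : EuclideanSpace ℝ ι ≃ₗᵢ[ℝ] EuclideanSpace ℝ ι) {ε : ℝ} (hε : 0 ≤ ε)
    (hG : ∀ v, ‖G v - v‖ ≤ ε * ‖v‖)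
    (hxG : x (2 * Real.pi) = G (x 0)) (hyG : y (2 * Real.pi) = G (y 0)) :
    |∫ t in (0 : ℝ)..(2 * Real.pi), inner ℝ (x' t) (y t)| ≤
      l2 x' * l2 y' + 3 * ε * (l2 x + l2 x') * l2 y := by
  have hT := Real.two_pi_pos
  have hT1 : (1 : ℝ) ≤ 2 * Real.pi := by linarith [Real.pi_gt_three]
  set T := 2 * Real.pi with hTdef
  have hyc : ContinuousOn y (Icc 0 T) := fun t ht => (hy t ht).continuousAt.continuousWithinAt
  -- K = G⁻¹ - 1 has norm at most ε. Adding (t/T) K y interpolates linearly from y to G⁻¹ y, so that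
  -- z T = G⁻¹ (G (y 0)) = y 0 = z 0.
  obtain ⟨K, hK⟩ : ∃ K : EuclideanSpace ℝ ι →L[ℝ] EuclideanSpace ℝ ι, ∀ v, K v = G.symm v - v :=
    ⟨(G.symm : EuclideanSpace ℝ ι →L[ℝ] EuclideanSpace ℝ ι) - ContinuousLinearMap.id ℝ _,
      fun v => rfl⟩
  have hKn : ∀ v, ‖K v‖ ≤ ε * ‖v‖ := fun v => by
    have := hG (G.symm v)
    rwa [G.apply_symm_apply, norm_sub_rev, G.symm.norm_map, ← hK] at this
  let z : ℝ → EuclideanSpace ℝ ι := fun t => y t + (t / T) • K (y t)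
  let z' : ℝ → EuclideanSpace ℝ ι := fun t => y' t + (t / T) • K (y' t) + (1 / T) • K (y t)
  have hzd : ∀ t ∈ Icc 0 T, HasDerivAt z (z' t) t := fun t ht => by
    have h1 := K.hasFDerivAt.comp_hasDerivAt t (hy t ht)
    have h2 := (hy t ht).fun_add (((hasDerivAt_id' t).div_const T).fun_smul h1)
    rwa [← add_assoc] at h2
  have hKy : ContinuousOn (fun t => K (y t)) (Icc 0 T) := K.continuous.comp_continuousOn hyc
  have hKy' : ContinuousOn (fun t => K (y' t)) (Icc 0 T) := K.continuous.comp_continuousOn hy'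
  have hz' : ContinuousOn z' (Icc 0 T) := by
    have h1 : ContinuousOn (fun t : ℝ => t / T) (Icc 0 T) := continuousOn_id.div_const T
    exact (hy'.fun_add (h1.fun_smul hKy')).fun_add (hKy.const_smul (1 / T))
  have hzc : ContinuousOn z (Icc 0 T) := fun t ht => (hzd t ht).continuousAt.continuousWithinAt
  -- The vector is a convex combination of v and G⁻¹ v, which have equal norm. Hence the correction
  -- costs no factor in front of ‖y'‖, and the leading constant stays 1.
  have hconv : ∀ t ∈ Icc 0 T, ∀ v, ‖v + (t / T) • K v‖ ≤ ‖v‖ := fun t ht v => by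
    have e : v + (t / T) • K v = (1 - t / T) • v + (t / T) • G.symm v := by
      rw [hK]; module
    have h0 : 0 ≤ t / T := div_nonneg ht.1 hT.le
    have h1 : t / T ≤ 1 := (div_le_one hT).2 ht.2
    rw [e]
    refine (norm_add_le _ _).trans ?_
    rw [norm_smul, norm_smul, G.symm.norm_map, Real.norm_of_nonneg h0,
      Real.norm_of_nonneg (sub_nonneg.2 h1)]
    exact le_of_eq (by ring)
  have hzper : z T = z 0 := by
    simp only [z, hK, hyG, div_self hT.ne', zero_div, G.symm_apply_apply]
    simp
  have hz'n : l2 z' ≤ l2 y' + ε * l2 y := by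
    refine l2_le_add hy' hyc hz' hε fun t ht => (norm_add_le _ _).trans
      (add_le_add (hconv t ht _) ?_)
    rw [norm_smul, Real.norm_of_nonneg (by positivity)]
    refine (mul_le_of_le_one_left (norm_nonneg _) ?_).trans (hKn _)
    exact (div_le_one hT).2 hT1
  let c : EuclideanSpace ℝ ι := (1 / T) • ∫ t in (0 : ℝ)..T, z t
  have hzint : IntervalIntegrable z volume 0 T := hzc.intervalIntegrable_of_Icc hT.le
  have hmean : ∫ t in (0 : ℝ)..T, (z t - c) = 0 := by
    rw [integral_sub hzint intervalIntegrable_const, intervalIntegral.integral_const, sub_zero,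
      smul_smul, mul_one_div_cancel hT.ne', one_smul, sub_self]
  have hzcl : l2 (fun t => z t - c) ≤ l2 z' :=
    wirtinger (fun t ht => (hzd t ht).sub_const c) hz' (by rw [hzper]) hmean
  have hcn : √T * ‖c‖ ≤ l2 y := by
    have h1 : ‖∫ t in (0 : ℝ)..T, z t‖ ≤ √T * l2 y := by
      refine (intervalIntegral.norm_integral_le_integral_norm hT.le).trans ?_
      refine le_trans ?_ (integral_norm_le_l2 hyc)
      exact integral_mono_on hT.le (hzc.norm.intervalIntegrable_of_Icc hT.le)
        (hyc.norm.intervalIntegrable_of_Icc hT.le) fun t ht => hconv t ht _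
    have h2 : √T * ‖c‖ = (1 / T) * (√T * ‖∫ t in (0 : ℝ)..T, z t‖) := by
      rw [norm_smul, Real.norm_of_nonneg (by positivity)]; ring
    rw [h2, one_div_mul_eq_div, div_le_iff₀ hT]
    calc √T * ‖∫ t in (0 : ℝ)..T, z t‖ ≤ √T * (√T * l2 y) := by gcongr
      _ = l2 y * T := by rw [← mul_assoc, Real.mul_self_sqrt hT.le, mul_comm]
  have hzcc : ContinuousOn (fun t => z t - c) (Icc 0 T) := hzc.sub continuousOn_const
  have hyz : ContinuousOn (fun t => y t - z t) (Icc 0 T) := hyc.sub hzc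
  -- y = (z - c) + c + (y - z): Wirtinger for the first summand, an endpoint term for the second,
  -- and ‖y - z‖ ≤ ε‖y‖ for the third.
  have hsplit : ∫ t in (0 : ℝ)..T, inner ℝ (x' t) (y t) =
      (∫ t in (0 : ℝ)..T, inner ℝ (x' t) (z t - c)) + (∫ t in (0 : ℝ)..T, inner ℝ (x' t) c) +
        ∫ t in (0 : ℝ)..T, inner ℝ (x' t) (y t - z t) := by
    rw [← integral_add ((hx'.inner hzcc).intervalIntegrable_of_Icc hT.le)
      ((hx'.inner continuousOn_const).intervalIntegrable_of_Icc hT.le),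
      ← integral_add (((hx'.inner hzcc).add (hx'.inner continuousOn_const)).intervalIntegrable_of_Icc
        hT.le) ((hx'.inner hyz).intervalIntegrable_of_Icc hT.le)]
    refine integral_congr fun t _ => ?_
    simp only [← inner_add_right]
    congr 1
    abel
  have hcs : ∀ {w : ℝ → EuclideanSpace ℝ ι}, ContinuousOn w (Icc 0 T) →
      |∫ t in (0 : ℝ)..T, inner ℝ (x' t) (w t)| ≤ l2 x' * l2 w := fun {w} hw => by
    refine (norm_integral_le_integral_norm (f := fun t => inner ℝ (x' t) (w t)) hT.le).trans ?_
    refine le_trans ?_ (integral_norm_mul_norm_le hx' hw)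
    exact integral_mono_on hT.le ((hx'.inner hw).norm.intervalIntegrable_of_Icc hT.le)
      ((hx'.norm.mul hw.norm).intervalIntegrable_of_Icc hT.le) fun t _ => norm_inner_le_norm _ _
  have hA : |∫ t in (0 : ℝ)..T, inner ℝ (x' t) (z t - c)| ≤ l2 x' * (l2 y' + ε * l2 y) :=
    (hcs hzcc).trans (mul_le_mul_of_nonneg_left (hzcl.trans hz'n) (l2_nonneg _))
  have hC : |∫ t in (0 : ℝ)..T, inner ℝ (x' t) (y t - z t)| ≤ l2 x' * (ε * l2 y) := by
    refine (hcs hyz).trans (mul_le_mul_of_nonneg_left ?_ (l2_nonneg _))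
    have h0 : l2 (fun _ : ℝ => (0 : ℝ)) = 0 := by simp [l2]
    have := l2_le_add (f := fun _ => (0 : ℝ)) continuousOn_const hyc hyz hε fun t ht => ?_
    · rwa [h0, zero_add] at this
    · have e : y t - z t = -((t / T) • K (y t)) := by simp [z]
      rw [e, norm_neg, norm_zero, zero_add, norm_smul,
        Real.norm_of_nonneg (div_nonneg ht.1 hT.le)]
      exact (mul_le_of_le_one_left (norm_nonneg _) ((div_le_one hT).2 ht.2)).trans (hKn _)
  have hB : |∫ t in (0 : ℝ)..T, inner ℝ (x' t) c| ≤ ε * (l2 x + l2 x') * l2 y := by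
    have h1 : ∫ t in (0 : ℝ)..T, inner ℝ (x' t) c = inner ℝ (x T - x 0) c := by
      rw [integral_eq_sub_of_hasDerivAt (f := fun t => inner ℝ (x t) c) (fun t ht => ?_)
        ((hx'.inner continuousOn_const).intervalIntegrable_of_Icc hT.le), inner_sub_left]
      rw [uIcc_of_le hT.le] at ht
      simpa using (hx t ht).inner ℝ (hasDerivAt_const t c)
    have h2 : ‖x T - x 0‖ ≤ ε * ‖x T‖ := by
      rw [hxG, G.norm_map]; exact hG _
    have h3 := norm_endpoint_le hx hx'
    have hs : 0 < √T := Real.sqrt_pos.2 hT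
    have hcn' : ‖c‖ ≤ l2 y / √T := by rwa [le_div_iff₀ hs, mul_comm]
    have h3' : ‖x T‖ ≤ (l2 x + T * l2 x') / √T := by rwa [le_div_iff₀ hs, mul_comm]
    rw [h1]
    have hnn := l2_nonneg x
    have hnn' := l2_nonneg x'
    have hny := l2_nonneg y
    calc |inner ℝ (x T - x 0) c| ≤ ‖x T - x 0‖ * ‖c‖ := abs_real_inner_le_norm _ _
      _ ≤ (ε * ((l2 x + T * l2 x') / √T)) * (l2 y / √T) := by
          gcongr
          exact h2.trans (by gcongr)
      _ = ε * ((l2 x + T * l2 x') / T) * l2 y := by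
          rw [div_eq_mul_inv _ T, ← Real.mul_self_sqrt hT.le, mul_inv, Real.mul_self_sqrt hT.le]
          ring
      _ ≤ ε * (l2 x + l2 x') * l2 y := by
          gcongr
          rw [div_le_iff₀ hT]
          nlinarith
  rw [hsplit]
  refine (abs_add_three _ _ _).trans ?_
  -- The errors add up to ε (‖x‖ + 3‖x'‖) ‖y‖; the 3 comes from one contribution of ‖x'‖ in each of
  -- the three terms.
  have h5 : 0 ≤ ε * l2 x * l2 y :=
    mul_nonneg (mul_nonneg hε (l2_nonneg _)) (l2_nonneg _)
  nlinarith

end Twisted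

/-! ### Linear equations and the quadratic holonomy estimate -/

section ODE

variable {F : Type*} [NormedAddCommGroup F] [NormedSpace ℝ F] [CompleteSpace F]

/-- Since the integral of ‖a‖ is at most 1/2, the Picard operator is already a contraction of C([0,
T]) in the sup norm. Its fixed point satisfies ‖v‖ ≤ ‖w‖ + ‖v‖/2, whence the factor 2. -/
lemma exists_linear_ode {a : ℝ → F →L[ℝ] F} (ha : Continuous a) {T : ℝ} (hT : 0 ≤ T)
    (hint : ∫ t in (0 : ℝ)..T, ‖a t‖ ≤ 1 / 2) (w : F) :
    ∃ u : ℝ → F, u 0 = w ∧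
      ∀ t ∈ Icc 0 T, HasDerivAt u (-(a t (u t))) t ∧ ‖u t‖ ≤ 2 * ‖w‖ := by
  -- Extending v by constants makes the integrand continuous on all of ℝ, so the solution has
  -- two-sided derivatives at 0 and T as well.
  have hI : ∀ v : C(Icc 0 T, F), Continuous fun s : ℝ => a s (v (projIcc 0 T hT s)) := fun v =>
    ha.clm_apply (v.continuous.comp continuous_projIcc)
  have hIc : ∀ v : C(Icc 0 T, F),
      Continuous fun t : ℝ => ∫ s in (0 : ℝ)..t, a s (v (projIcc 0 T hT s)) := fun v =>
    intervalIntegral.continuous_primitive (fun _ _ => (hI v).intervalIntegrable _ _) 0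
  let Φ : C(Icc 0 T, F) → C(Icc 0 T, F) := fun v =>
    ⟨fun t => w - ∫ s in (0 : ℝ)..(t : ℝ), a s (v (projIcc 0 T hT s)),
      continuous_const.sub ((hIc v).comp continuous_subtype_val)⟩
  have hbd : ∀ v : C(Icc 0 T, F), ∀ t ∈ Icc 0 T,
      ‖∫ s in (0 : ℝ)..t, a s (v (projIcc 0 T hT s))‖ ≤ 1 / 2 * ‖v‖ := fun v t ht => by
    have hle : ∫ s in (0 : ℝ)..t, ‖a s‖ ≤ 1 / 2 := by
      refine le_trans ?_ hint
      exact integral_mono_interval le_rfl ht.1 ht.2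
        (Filter.Eventually.of_forall fun _ => norm_nonneg _) (ha.norm.intervalIntegrable _ _)
    calc ‖∫ s in (0 : ℝ)..t, a s (v (projIcc 0 T hT s))‖
        ≤ ∫ s in (0 : ℝ)..t, ‖a s‖ * ‖v‖ := by
          refine norm_integral_le_of_norm_le ht.1 (Filter.Eventually.of_forall fun s _ => ?_)
            ((ha.norm.mul continuous_const).intervalIntegrable _ _)
          exact (a s).le_of_opNorm_le_of_le le_rfl (v.norm_coe_le_norm _)
      _ = (∫ s in (0 : ℝ)..t, ‖a s‖) * ‖v‖ := intervalIntegral.integral_mul_const _ _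
      _ ≤ 1 / 2 * ‖v‖ := by gcongr
  have hΦ : ContractingWith (1 / 2) Φ := by
    refine ⟨by norm_num, LipschitzWith.of_dist_le_mul fun v v' => ?_⟩
    rw [dist_eq_norm, dist_eq_norm]
    refine (ContinuousMap.norm_le _ (by positivity)).2 fun t => ?_
    have e : (Φ v - Φ v') t = -∫ s in (0 : ℝ)..(t : ℝ), a s ((v - v') (projIcc 0 T hT s)) := by
      simp only [Φ, ContinuousMap.sub_apply, ContinuousMap.coe_mk, map_sub]
      rw [integral_sub ((hI v).intervalIntegrable _ _) ((hI v').intervalIntegrable _ _)]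
      abel
    rw [e, norm_neg]
    simpa using hbd (v - v') t t.2
  obtain ⟨v, hv⟩ : ∃ v, Φ v = v := ⟨_, hΦ.fixedPoint_isFixedPt⟩
  have hvt : ∀ t (ht : t ∈ Icc 0 T),
      v ⟨t, ht⟩ = w - ∫ s in (0 : ℝ)..t, a s (v (projIcc 0 T hT s)) := fun t ht => by
    conv_lhs => rw [← hv]
    rfl
  have hvn : ‖v‖ ≤ 2 * ‖w‖ := by
    have : ‖v‖ ≤ ‖w‖ + 1 / 2 * ‖v‖ := by
      refine (ContinuousMap.norm_le _ (by positivity)).2 fun t => ?_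
      rw [hvt t t.2]
      exact (norm_sub_le _ _).trans (add_le_add_right (hbd v t t.2) _)
    linarith
  refine ⟨fun t => w - ∫ s in (0 : ℝ)..t, a s (v (projIcc 0 T hT s)), by simp, fun t ht => ⟨?_, ?_⟩⟩
  · have h := ((hI v).integral_hasStrictDerivAt 0 t).hasDerivAt.const_sub w
    rw [projIcc_of_mem hT ht, hvt t ht] at h
    exact h
  · simp only [← hvt t ht]
    exact (v.norm_coe_le_norm _).trans hvn

/-- The holonomy of a connection with Lipschitz coefficients along a short closed curve is
quadratically close to the identity. -/
lemma norm_holonomy_sub_le {X : Type*} [NormedAddCommGroup X] [NormedSpace ℝ X] [CompleteSpace X]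
    {Γ : X → X →L[ℝ] F →L[ℝ] F} {s : Set X} {k : ℝ} (hk : 0 ≤ k) (hΓ : ∀ x ∈ s, ‖Γ x‖ ≤ k)
    (hΓl : ∀ x ∈ s, ∀ y ∈ s, ‖Γ x - Γ y‖ ≤ k * ‖x - y‖)
    {c c' : ℝ → X} {T : ℝ} (hT : 0 ≤ T) (hc : ∀ t, HasDerivAt c (c' t) t) (hc' : Continuous c')
    (hcs : ∀ t, c t ∈ s) (hper : c T = c 0) (hΓc : Continuous fun t => Γ (c t)) {w : F} {u : ℝ → F}
    (hu0 : u 0 = w)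
    (hu : ∀ t ∈ Icc 0 T, HasDerivAt u (-(Γ (c t) (c' t) (u t))) t ∧ ‖u t‖ ≤ 2 * ‖w‖) :
    ‖u T - w‖ ≤ (2 * k + 2 * k ^ 2) * (∫ t in (0 : ℝ)..T, ‖c' t‖) ^ 2 * ‖w‖ := by
  set ℓ := ∫ t in (0 : ℝ)..T, ‖c' t‖ with hℓ
  have hℓ0 : 0 ≤ ℓ := integral_nonneg hT fun _ _ => norm_nonneg _
  have hcc : Continuous c := continuous_iff_continuousAt.2 fun t => (hc t).continuousAt
  have huc : ContinuousOn u (Icc 0 T) := fun t ht => (hu t ht).1.continuousAt.continuousWithinAt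
  have hdist : ∀ t ∈ Icc 0 T, ‖c t - c 0‖ ≤ ℓ := fun t ht => by
    rw [← integral_eq_sub_of_hasDerivAt (fun t _ => hc t) (hc'.intervalIntegrable _ _)]
    refine (intervalIntegral.norm_integral_le_integral_norm ht.1).trans ?_
    exact integral_mono_interval le_rfl ht.1 ht.2
      (Filter.Eventually.of_forall fun _ => norm_nonneg _) (hc'.norm.intervalIntegrable _ _)
  have hΓu : ContinuousOn (fun t => Γ (c t) (c' t) (u t)) (Icc 0 T) :=
    (hΓc.clm_apply hc').continuousOn.clm_apply huc
  have hΓ0u : ContinuousOn (fun t => Γ (c 0) (c' t) (u t)) (Icc 0 T) :=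
    (continuous_const.clm_apply hc').continuousOn.clm_apply huc
  have hq : ContinuousOn (fun t => Γ (c 0) (c t - c 0) (Γ (c t) (c' t) (u t))) (Icc 0 T) :=
    (continuous_const.clm_apply (hcc.sub continuous_const)).continuousOn.clm_apply hΓu
  have hend : ∫ t in (0 : ℝ)..T, -(Γ (c t) (c' t) (u t)) = u T - w := by
    rw [integral_eq_sub_of_hasDerivAt (fun t ht => (hu t (by rwa [uIcc_of_le hT] at ht)).1)
      (hΓu.neg.intervalIntegrable_of_Icc hT), hu0]
  have hi : IntervalIntegrable (fun t => Γ (c 0) (c' t) (u t) -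
      Γ (c 0) (c t - c 0) (Γ (c t) (c' t) (u t))) volume 0 T :=
    (hΓ0u.sub hq).intervalIntegrable_of_Icc hT
  -- The integrand is the derivative of Γ(c 0)(c t - c 0)(u t), which vanishes at both ends because
  -- the curve is closed.
  have hparts : ∫ t in (0 : ℝ)..T,
      (Γ (c 0) (c' t) (u t) - Γ (c 0) (c t - c 0) (Γ (c t) (c' t) (u t))) = 0 := by
    rw [integral_eq_sub_of_hasDerivAt (f := fun t => Γ (c 0) (c t - c 0) (u t)) (fun t ht => ?_)
      hi]
    · simp [hper]
    · rw [uIcc_of_le hT] at ht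
      have h1 := (Γ (c 0)).hasFDerivAt.comp_hasDerivAt t ((hc t).sub_const (c 0))
      have h2 := h1.clm_apply (hu t ht).1
      rwa [map_neg, ← sub_eq_add_neg] at h2
  -- Freezing Γ at c 0 costs a Lipschitz term, and integrating the frozen term by parts leaves one
  -- containing u'. Each carries a factor ‖c t - c 0‖ ≤ ℓ besides ‖c'‖, hence is O(ℓ²).
  have hsplit : u T - w = (∫ t in (0 : ℝ)..T, -((Γ (c t) - Γ (c 0)) (c' t) (u t))) -
      ∫ t in (0 : ℝ)..T, Γ (c 0) (c t - c 0) (Γ (c t) (c' t) (u t)) := by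
    have h1 : IntervalIntegrable (fun t => -((Γ (c t) - Γ (c 0)) (c' t) (u t))) volume 0 T := by
      exact (hΓu.sub hΓ0u).neg.intervalIntegrable_of_Icc hT
    rw [← hend, ← integral_sub h1 (hq.intervalIntegrable_of_Icc hT), ← sub_zero
      (∫ t in (0 : ℝ)..T, (-((Γ (c t) - Γ (c 0)) (c' t) (u t)) - _)), ← hparts,
      ← integral_sub (h1.sub (hq.intervalIntegrable_of_Icc hT)) hi]
    refine integral_congr fun t _ => ?_
    simp only [sub_apply]
    abel
  have hc0 := hcs 0
  have b1 : ‖∫ t in (0 : ℝ)..T, -((Γ (c t) - Γ (c 0)) (c' t) (u t))‖ ≤ k * ℓ * ℓ * (2 * ‖w‖) := by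
    calc _ ≤ ∫ t in (0 : ℝ)..T, k * ℓ * ‖c' t‖ * (2 * ‖w‖) := by
          refine norm_integral_le_of_norm_le hT (Filter.Eventually.of_forall fun t ht => ?_)
            (((continuous_const.mul hc'.norm).mul continuous_const).intervalIntegrable _ _)
          have ht' := Ioc_subset_Icc_self ht
          rw [norm_neg]
          refine ContinuousLinearMap.le_of_opNorm_le_of_le _ ?_ (hu t ht').2
          refine ContinuousLinearMap.le_of_opNorm_le _ ?_ _
          exact (hΓl _ (hcs t) _ hc0).trans (by gcongr; exact hdist t ht')
      _ = _ := by
          rw [intervalIntegral.integral_mul_const, intervalIntegral.integral_const_mul]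
  have b2 : ‖∫ t in (0 : ℝ)..T, Γ (c 0) (c t - c 0) (Γ (c t) (c' t) (u t))‖ ≤
      k * ℓ * (k * ℓ * (2 * ‖w‖)) := by
    calc _ ≤ ∫ t in (0 : ℝ)..T, k * ℓ * (k * ‖c' t‖ * (2 * ‖w‖)) := by
          refine norm_integral_le_of_norm_le hT (Filter.Eventually.of_forall fun t ht => ?_)
            ((continuous_const.mul ((continuous_const.mul hc'.norm).mul
              continuous_const)).intervalIntegrable _ _)
          have ht' := Ioc_subset_Icc_self ht
          refine ContinuousLinearMap.le_of_opNorm_le_of_le _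
            (ContinuousLinearMap.le_of_opNorm_le_of_le _ (hΓ _ hc0) (hdist t ht')) ?_
          refine ContinuousLinearMap.le_of_opNorm_le_of_le _ ?_ (hu t ht').2
          exact ContinuousLinearMap.le_of_opNorm_le _ (hΓ _ (hcs t)) _
      _ = _ := by
          rw [intervalIntegral.integral_const_mul, intervalIntegral.integral_mul_const,
            intervalIntegral.integral_const_mul]
  rw [hsplit]
  refine (norm_sub_le _ _).trans ((add_le_add b1 b2).trans (le_of_eq ?_))
  ring

end ODE

/-! ### Connections in a local trivialization -/

section Connection

variable {EM : Type*} [NormedAddCommGroup EM] [NormedSpace ℝ EM]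
  {HM : Type*} [TopologicalSpace HM] {I : ModelWithCorners ℝ EM HM}
  {M : Type*} [TopologicalSpace M] [ChartedSpace HM M]
  {F : Type*} [NormedAddCommGroup F] [NormedSpace ℝ F]
  {E : M → Type*} [TopologicalSpace (TotalSpace F E)]
  [∀ x, NormedAddCommGroup (E x)] [∀ x, InnerProductSpace ℝ (E x)]
  [FiberBundle F E] [VectorBundle ℝ F E]

lemma hasDerivAt_comp_curve {V : Type*} [NormedAddCommGroup V] [NormedSpace ℝ V] {h : M → V}
    {γ : ℝ → M} {t : ℝ} (hh : MDiffAt h (γ t)) (hγ : MDiffAt γ t) :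
    HasDerivAt (fun s => h (γ s)) (mvfderiv I h (γ t) (velocity I γ t)) t := by
  have h1 : HasFDerivAt (h ∘ γ) ((mvfderiv I h (γ t)).comp (mfderiv 𝓘(ℝ, ℝ) I γ t) : ℝ →L[ℝ] V) t :=
    (hh.hasMFDerivAt.comp t hγ.hasMFDerivAt).hasFDerivAt
  exact h1.hasDerivAt

lemma cov_sum_smul (cov : CovariantDerivative I F E) {ι : Type*} (s : Finset ι) {g : ι → M → ℝ}
    {τ : ι → ∀ x, E x} {x : M} (hg : ∀ i, MDiffAt (g i) x) (hτ : ∀ i, MDiffAt (T% (τ i)) x)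
    (v : TangentSpace I x) :
    cov (fun y => ∑ i ∈ s, g i y • τ i y) x v =
      ∑ i ∈ s, (g i x • cov (τ i) x v + mvfderiv I (g i) x v • τ i x) := by
  classical
  have hd : ∀ s : Finset ι, MDiffAt (T% (fun y => ∑ i ∈ s, g i y • τ i y)) x := fun s =>
    MDifferentiableAt.sum_section fun i _ => (hg i).smul_section (hτ i)
  induction s using Finset.induction_on with
  | empty =>
    have : cov (0 : ∀ x, E x) x = 0 := by rw [cov.zero]; rfl
    exact congr($this v)
  | insert i s hi ih =>
    have e : (fun y => ∑ j ∈ insert i s, g j y • τ j y) =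
        (g i • τ i) + fun y => ∑ j ∈ s, g j y • τ j y := by
      ext y
      rw [Finset.sum_insert hi]
      rfl
    rw [e, cov.isCovariantDerivativeOnUniv.add ((hg i).smul_section (hτ i)) (hd s),
      cov.isCovariantDerivativeOnUniv.leibniz (hτ i) (hg i), Finset.sum_insert hi, ← ih]
    simp

variable [ContMDiffVectorBundle 1 F E I]

lemma mdifferentiableAt_symmL_const (e : Trivialization F (π F E)) [MemTrivializationAtlas e]
    {x : M} (hx : x ∈ e.baseSet) (w : F) : MDiffAt (T% (fun y => e.symmL ℝ y w)) x := by
  rw [e.mdifferentiableAt_section_iff I _ hx]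
  refine (mdifferentiableAt_const (c := w)).congr_of_eventuallyEq ?_
  filter_upwards [e.open_baseSet.mem_nhds hx] with y hy
  rw [← e.continuousLinearMapAt_apply_of_mem (R := ℝ) hy, e.continuousLinearMapAt_symmL hy]

lemma mdifferentiableAt_coord (e : Trivialization F (π F E)) [MemTrivializationAtlas e]
    {σ : ∀ x, E x} {x : M} (hx : x ∈ e.baseSet) (hσ : MDiffAt (T% σ) x) :
    MDiffAt (fun y => e.continuousLinearMapAt ℝ y (σ y)) x := by
  refine ((e.mdifferentiableAt_section_iff I σ hx).1 hσ).congr_of_eventuallyEq ?_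
  filter_upwards [e.open_baseSet.mem_nhds hx] with y hy
  rw [e.continuousLinearMapAt_apply_of_mem (R := ℝ) hy]

lemma eq_sum_coord (e : Trivialization F (π F E)) [MemTrivializationAtlas e] {ι : Type*}
    [Fintype ι] (b : Module.Basis ι ℝ F) {x : M} (hx : x ∈ e.baseSet) (v : E x) :
    v = ∑ i, b.repr (e.continuousLinearMapAt ℝ x v) i • e.symmL ℝ x (b i) := by
  conv_lhs => rw [← e.symmL_continuousLinearMapAt (R := ℝ) hx v,
    ← b.sum_repr (e.continuousLinearMapAt ℝ x v)]
  simp only [map_sum, map_smul]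

variable [FiniteDimensional ℝ F]

/-- The covariant derivative of a section in terms of its coordinates in a trivialization. -/
lemma cov_eq_coord (cov : CovariantDerivative I F E) (e : Trivialization F (π F E))
    [MemTrivializationAtlas e] {σ : ∀ x, E x} {x : M} (hx : x ∈ e.baseSet)
    (hσ : MDiffAt (T% σ) x) (v : TangentSpace I x) :
    cov σ x v = e.symmL ℝ x (mvfderiv I (fun y => e.continuousLinearMapAt ℝ y (σ y)) x v) +
      cov (fun y => e.symmL ℝ y (e.continuousLinearMapAt ℝ x (σ x))) x v := by
  let b := Module.finBasis ℝ F
  set h : M → F := fun y => e.continuousLinearMapAt ℝ y (σ y) with hh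
  have hhd : MDiffAt h x := mdifferentiableAt_coord e hx hσ
  let p : Fin (Module.finrank ℝ F) → F →L[ℝ] ℝ := fun i => LinearMap.toContinuousLinearMap (b.coord i)
  have hp : ∀ i w, p i w = b.repr w i := fun i w => rfl
  have hsum : ∀ w, w = ∑ i, p i w • b i := fun w => (b.sum_repr w).symm
  have hpd : ∀ i, MDiffAt (fun y => p i (h y)) x := fun i =>
    ((p i).differentiableAt.mdifferentiableAt (x := h x)).comp x hhd
  have hpv : ∀ i, mvfderiv I (fun y => p i (h y)) x v = p i (mvfderiv I h x v) := fun i => by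
    have := ((p i).hasMFDerivAt (x := h x)).comp x hhd.hasMFDerivAt
    have e1 := this.mfderiv
    simp only [mvfderiv]
    exact congr($e1 v)
  have hτ := fun i => mdifferentiableAt_symmL_const (I := I) e hx (b i)
  -- The expansion in the local frame holds only over the base set; this suffices because `cov`
  -- depends only on the germ of the section.
  have e1 : cov σ x v = cov (fun y => ∑ i, p i (h y) • e.symmL ℝ y (b i)) x v := by
    have := cov.isCovariantDerivativeOnUniv.congr_of_eventuallyEq hσ
      (σ' := fun y => ∑ i, p i (h y) • e.symmL ℝ y (b i))
      (MDifferentiableAt.sum_section fun i _ => (hpd i).smul_section (hτ i)) univ_mem ?_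
    · rw [this]
    · filter_upwards [e.open_baseSet.mem_nhds hx] with y hy using eq_sum_coord e b hy (σ y)
  have e2 : (fun y => e.symmL ℝ y (h x)) = fun y => ∑ i, p i (h x) • e.symmL ℝ y (b i) := by
    ext y
    conv_lhs => rw [hsum (h x)]
    simp only [map_sum, map_smul]
  rw [e1, cov_sum_smul cov Finset.univ hpd hτ, e2,
    cov_sum_smul cov Finset.univ (g := fun i _ => p i (h x)) (fun i => mdifferentiableAt_const) hτ]
  simp only [hpv, mvfderiv_const, zero_apply, zero_smul, add_zero, Finset.sum_add_distrib]
  rw [add_comm]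
  congr 1
  conv_rhs => rw [hsum (mvfderiv I h x v)]
  simp only [map_sum, map_smul]

end Connection

/-! ### Covariant derivative along a curve and its product rule -/

section AlongCurve

lemma inner_sum_smul_sum_smul {V : Type*} [NormedAddCommGroup V] [InnerProductSpace ℝ V]
    {ι κ : Type*} [Fintype ι] [Fintype κ] (a : ι → ℝ) (x : ι → V) (b : κ → ℝ) (y : κ → V) :
    inner ℝ (∑ i, a i • x i) (∑ j, b j • y j) = ∑ i, ∑ j, a i * b j * inner ℝ (x i) (y j) := by
  rw [sum_inner]
  refine Finset.sum_congr rfl fun i _ => ?_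
  rw [inner_sum]
  refine Finset.sum_congr rfl fun j _ => ?_
  rw [real_inner_smul_left, real_inner_smul_right, mul_assoc]

variable {EM : Type*} [NormedAddCommGroup EM] [NormedSpace ℝ EM]
  {HM : Type*} [TopologicalSpace HM] {I : ModelWithCorners ℝ EM HM}
  {M : Type*} [TopologicalSpace M] [ChartedSpace HM M]
  {F : Type*} [NormedAddCommGroup F] [NormedSpace ℝ F] [FiniteDimensional ℝ F]
  {E : M → Type*} [TopologicalSpace (TotalSpace F E)]
  [∀ x, NormedAddCommGroup (E x)] [∀ x, InnerProductSpace ℝ (E x)]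
  [FiberBundle F E] [VectorBundle ℝ F E] [ContMDiffVectorBundle 1 F E I]

/-- The covariant derivative along a curve of a combination of local sections. -/
lemma covDerivAlong_eq_sum (cov : CovariantDerivative I F E) {γ : ℝ → M} {t : ℝ}
    (hγ : MDiffAt γ t) {ι : Type*} [Fintype ι] {c : ι → ℝ → ℝ} {c' : ι → ℝ}
    {σ : ι → ∀ x, E x} (hc : ∀ i, HasDerivAt (c i) (c' i) t)
    (hσ : ∀ i, MDiffAt (T% (σ i)) (γ t)) {ξ : ∀ s, E (γ s)}
    (hξ : ∀ᶠ s in 𝓝 t, ξ s = ∑ i, c i s • σ i (γ s)) :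
    covDerivAlong cov γ ξ t =
      ∑ i, (c' i • σ i (γ t) + c i t • cov (σ i) (γ t) (velocity I γ t)) := by
  set e := trivializationAt F E (γ t)
  have ht : γ t ∈ e.baseSet := mem_baseSet_trivializationAt F E (γ t)
  have hb : e.baseSet ∈ 𝓝 (γ t) := e.open_baseSet.mem_nhds ht
  let h : ι → M → F := fun i y => e.continuousLinearMapAt ℝ y (σ i y)
  have hh : ∀ i, MDiffAt (h i) (γ t) := fun i => mdifferentiableAt_coord e ht (hσ i)
  let f : ℝ → F := fun s => (e ⟨γ s, ξ s⟩).2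
  have hf : f =ᶠ[𝓝 t] fun s => ∑ i, c i s • h i (γ s) := by
    filter_upwards [hξ, hγ.continuousAt hb] with s hs hsb
    change (e ⟨γ s, ξ s⟩).2 = _
    rw [← e.continuousLinearMapAt_apply_of_mem (R := ℝ) hsb, hs]
    simp only [map_sum, map_smul, h]
  set v := velocity I γ t
  have hfd : HasDerivAt f (∑ i, (c i t • mvfderiv I (h i) (γ t) v + c' i • h i (γ t))) t :=
    (HasDerivAt.fun_sum fun i _ => (hc i).fun_smul (hasDerivAt_comp_curve (hh i) hγ)).congr_of_eventuallyEq
      hf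
  have hτ : ∀ w, MDiffAt (T% (fun y => e.symmL ℝ y w)) (γ t) := fun w =>
    mdifferentiableAt_symmL_const e ht w
  have hcov : cov (fun x => e.symm x (f t)) (γ t) v =
      ∑ i, c i t • cov (fun y => e.symmL ℝ y (h i (γ t))) (γ t) v := by
    -- The definition uses `e.symm`; the linear version `e.symmL` agrees with it over the base set,
    -- and `cov` is local.
    have e1 : cov (fun x => e.symm x (f t)) (γ t) = cov (fun x => e.symmL ℝ x (f t)) (γ t) := by
      have hev : ∀ᶠ y in 𝓝 (γ t), e.symmL ℝ y (f t) = e.symm y (f t) := by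
        filter_upwards [hb] with y hy using e.symmL_apply hy _
      refine cov.isCovariantDerivativeOnUniv.congr_of_eventuallyEq ?_ (hτ _) univ_mem
        (hev.mono fun y hy => hy.symm)
      refine (hτ (f t)).congr_of_eventuallyEq ?_
      filter_upwards [hev] with y hy
      rw [hy]
    have e2 : (fun x => e.symmL ℝ x (f t)) =
        fun x => ∑ i, c i t • e.symmL ℝ x (h i (γ t)) := by
      ext x
      rw [hf.self_of_nhds]
      simp only [map_sum, map_smul]
    rw [e1, e2, cov_sum_smul cov Finset.univ (g := fun i _ => c i t)
      (fun i => mdifferentiableAt_const) (fun i => hτ _)]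
    simp only [mvfderiv_const, zero_apply, zero_smul, add_zero]
  have hD : covDerivAlong cov γ ξ t =
      e.symm (γ t) (deriv f t) + cov (fun x => e.symm x (f t)) (γ t) v := rfl
  rw [hD, hcov, hfd.deriv, ← e.symmL_apply (R := ℝ) ht]
  simp only [map_sum, map_smul, map_add]
  rw [← Finset.sum_add_distrib]
  refine Finset.sum_congr rfl fun i _ => ?_
  -- The derivative of the coordinates of `σ i` and the covariant derivative of the section with
  -- constant coordinates recombine to `cov (σ i)`, so the trivialization disappears from the
  -- formula.
  rw [cov_eq_coord cov e ht (hσ i) v, e.symmL_continuousLinearMapAt (R := ℝ) ht, smul_add]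
  abel

omit [FiniteDimensional ℝ F] in
lemma mdifferentiableAt_sum_along {γ : ℝ → M} {t : ℝ}
    (hγ : MDiffAt γ t) {ι : Type*} [Fintype ι] {c : ι → ℝ → ℝ}
    {σ : ι → ∀ x, E x} (hc : ∀ i, DifferentiableAt ℝ (c i) t)
    (hσ : ∀ i, MDiffAt (T% (σ i)) (γ t)) {ξ : ∀ s, E (γ s)}
    (hξ : ∀ᶠ s in 𝓝 t, ξ s = ∑ i, c i s • σ i (γ s)) :
    MDifferentiableAt 𝓘(ℝ, ℝ) (I.prod 𝓘(ℝ, F)) (fun s => TotalSpace.mk' F (γ s) (ξ s)) t := by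
  rw [mdifferentiableAt_totalSpace]
  refine ⟨hγ, ?_⟩
  set e := trivializationAt F E (γ t)
  have ht : γ t ∈ e.baseSet := mem_baseSet_trivializationAt F E (γ t)
  have hb : e.baseSet ∈ 𝓝 (γ t) := e.open_baseSet.mem_nhds ht
  let h : ι → M → F := fun i y => e.continuousLinearMapAt ℝ y (σ i y)
  have hh : ∀ i, MDiffAt (h i) (γ t) := fun i => mdifferentiableAt_coord e ht (hσ i)
  have hd : DifferentiableAt ℝ (fun s => ∑ i, c i s • h i (γ s)) t :=
    DifferentiableAt.fun_sum fun i _ =>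
      (hc i).fun_smul (hasDerivAt_comp_curve (hh i) hγ).differentiableAt
  refine hd.mdifferentiableAt.congr_of_eventuallyEq ?_
  filter_upwards [hξ, hγ.continuousAt hb] with s hs hsb
  change (e ⟨γ s, ξ s⟩).2 = _
  rw [← e.continuousLinearMapAt_apply_of_mem (R := ℝ) hsb, hs]
  simp only [map_sum, map_smul, h]

/-- A differentiable section along a curve is locally a combination of local sections. -/
lemma exists_eq_sum_along {γ : ℝ → M} {t : ℝ} {ξ : ∀ s, E (γ s)}
    (hξ : MDifferentiableAt 𝓘(ℝ, ℝ) (I.prod 𝓘(ℝ, F)) (fun s => TotalSpace.mk' F (γ s) (ξ s)) t) :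
    ∃ (c : Fin (Module.finrank ℝ F) → ℝ → ℝ) (σ : Fin (Module.finrank ℝ F) → ∀ x, E x),
      (∀ i, DifferentiableAt ℝ (c i) t) ∧ (∀ i, MDiffAt (T% (σ i)) (γ t)) ∧
      ∀ᶠ s in 𝓝 t, ξ s = ∑ i, c i s • σ i (γ s) := by
  rw [mdifferentiableAt_totalSpace] at hξ
  obtain ⟨hγ, hf⟩ := hξ
  change MDiffAt γ t at hγ
  set e := trivializationAt F E (γ t)
  have ht : γ t ∈ e.baseSet := mem_baseSet_trivializationAt F E (γ t)
  have hb : e.baseSet ∈ 𝓝 (γ t) := e.open_baseSet.mem_nhds ht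
  let b := Module.finBasis ℝ F
  let p : Fin (Module.finrank ℝ F) → F →L[ℝ] ℝ := fun i => LinearMap.toContinuousLinearMap (b.coord i)
  refine ⟨fun i s => p i (e ⟨γ s, ξ s⟩).2, fun i y => e.symmL ℝ y (b i), fun i => ?_,
    fun i => mdifferentiableAt_symmL_const e ht _, ?_⟩
  · exact (p i).differentiableAt.comp t hf.differentiableAt
  · filter_upwards [hγ.continuousAt hb] with s hs
    rw [← e.continuousLinearMapAt_apply_of_mem (R := ℝ) hs]
    exact eq_sum_coord e b hs (ξ s)

/-- A metric connection satisfies the product rule along curves. -/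
lemma hasDerivAt_inner_along [IsContMDiffRiemannianBundle I 1 F E] {cov : CovariantDerivative I F E}
    (hcov : cov.IsMetricCompatible) {γ : ℝ → M} {t : ℝ} {ξ η : ∀ s, E (γ s)}
    (hξ : MDifferentiableAt 𝓘(ℝ, ℝ) (I.prod 𝓘(ℝ, F)) (fun s => TotalSpace.mk' F (γ s) (ξ s)) t)
    (hη : MDifferentiableAt 𝓘(ℝ, ℝ) (I.prod 𝓘(ℝ, F)) (fun s => TotalSpace.mk' F (γ s) (η s)) t) :
    HasDerivAt (fun s => inner ℝ (ξ s) (η s))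
      (inner ℝ (covDerivAlong cov γ ξ t) (η t) + inner ℝ (ξ t) (covDerivAlong cov γ η t)) t := by
  have hγ : MDiffAt γ t := ((mdifferentiableAt_totalSpace I _).1 hξ).1
  obtain ⟨c, σ, hc, hσ, hsum⟩ := exists_eq_sum_along hξ
  obtain ⟨d, ρ, hd, hρ, hsum'⟩ := exists_eq_sum_along hη
  rw [covDerivAlong_eq_sum cov hγ (fun i => (hc i).hasDerivAt) hσ hsum,
    covDerivAlong_eq_sum cov hγ (fun i => (hd i).hasDerivAt) hρ hsum', hsum.self_of_nhds,
    hsum'.self_of_nhds]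
  set v := velocity I γ t
  have hin : ∀ i j, HasDerivAt (fun s => inner ℝ (σ i (γ s)) (ρ j (γ s)))
      (inner ℝ (cov (σ i) (γ t) v) (ρ j (γ t)) + inner ℝ (σ i (γ t)) (cov (ρ j) (γ t) v)) t := by
    intro i j
    have h1 := hasDerivAt_comp_curve ((hσ i).inner_bundle (hρ j)) hγ
    -- Compatibility is applied to a vector field; any field with value v at γ t serves, here the
    -- constant one under the identification of tangent spaces with `EM`.
    have h2 := hcov.mvfderiv_inner_eq (x := γ t) (fun _ => (show EM from v)) (hσ i) (hρ j)
    exact h1.congr_deriv h2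
  have hd := HasDerivAt.fun_sum (u := Finset.univ) fun i _ =>
    HasDerivAt.fun_sum (u := Finset.univ) fun j _ =>
    ((hc i).hasDerivAt.fun_mul (hd j).hasDerivAt).fun_mul (hin i j)
  refine (hd.congr_of_eventuallyEq (f₁ := fun s => inner ℝ (ξ s) (η s)) ?_).congr_deriv ?_
  · filter_upwards [hsum, hsum'] with s hs hs'
    rw [hs, hs']
    exact inner_sum_smul_sum_smul _ _ _ _
  · simp only [Finset.sum_add_distrib, inner_add_left, inner_add_right, inner_sum_smul_sum_smul]
    simp only [← Finset.sum_add_distrib]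
    refine Finset.sum_congr rfl fun i _ => Finset.sum_congr rfl fun j _ => ?_
    ring

end AlongCurve

/-! ### Smooth sections, complex structure and continuity along curves -/

section Smooth

variable {EM : Type*} [NormedAddCommGroup EM] [NormedSpace ℝ EM]
  {HM : Type*} [TopologicalSpace HM] {I : ModelWithCorners ℝ EM HM}
  {M : Type*} [TopologicalSpace M] [ChartedSpace HM M]
  {F : Type*} [NormedAddCommGroup F] [NormedSpace ℝ F]
  {E : M → Type*} [TopologicalSpace (TotalSpace F E)]
  [∀ x, NormedAddCommGroup (E x)] [∀ x, InnerProductSpace ℝ (E x)]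
  [FiberBundle F E] [VectorBundle ℝ F E]

lemma contMDiff_lincomb_along {EN : Type*} [NormedAddCommGroup EN] [NormedSpace ℝ EN]
    {HN : Type*} [TopologicalSpace HN] {IN : ModelWithCorners ℝ EN HN}
    {N : Type*} [TopologicalSpace N] [ChartedSpace HN N] {α : N → M} {ξ η : ∀ z, E (α z)}
    (hξ : ContMDiff IN (I.prod 𝓘(ℝ, F)) ∞ (fun z => TotalSpace.mk' F (α z) (ξ z)))
    (hη : ContMDiff IN (I.prod 𝓘(ℝ, F)) ∞ (fun z => TotalSpace.mk' F (α z) (η z))) (a b : ℝ) :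
    ContMDiff IN (I.prod 𝓘(ℝ, F)) ∞
      (fun z => TotalSpace.mk' F (α z) (a • ξ z + b • η z)) := by
  intro z
  have h1 := contMDiffAt_totalSpace.1 (hξ z)
  have h2 := contMDiffAt_totalSpace.1 (hη z)
  refine contMDiffAt_totalSpace.2 ⟨h1.1, ?_⟩
  set e := trivializationAt F E (α z)
  have h3 : ContMDiffAt IN 𝓘(ℝ, F) ∞ (fun w => (e ⟨α w, ξ w⟩).2) z := h1.2
  have h4 : ContMDiffAt IN 𝓘(ℝ, F) ∞ (fun w => (e ⟨α w, η w⟩).2) z := h2.2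
  refine (((contMDiffAt_const (I' := 𝓘(ℝ, ℝ)) (c := a)).smul h3).add
    ((contMDiffAt_const (I' := 𝓘(ℝ, ℝ)) (c := b)).smul h4)).congr_of_eventuallyEq ?_
  have hb : e.baseSet ∈ 𝓝 (α z) :=
    e.open_baseSet.mem_nhds (mem_baseSet_trivializationAt F E (α z))
  filter_upwards [h1.1.continuousAt hb] with w hw
  change (e ⟨α w, a • ξ w + b • η w⟩).2 = a • (e ⟨α w, ξ w⟩).2 + b • (e ⟨α w, η w⟩).2
  simp only [← e.continuousLinearMapAt_apply_of_mem (R := ℝ) hw, map_add, map_smul]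

lemma continuous_velocity [IsManifold I 1 M] {γ : ℝ → M} (hγ : ContMDiff 𝓘(ℝ, ℝ) I 1 γ) :
    Continuous (fun t => TotalSpace.mk' EM (E := fun x : M => TangentSpace I x) (γ t)
      (velocity I γ t)) := by
  have h1 : Continuous (tangentMap 𝓘(ℝ, ℝ) I γ) := hγ.continuous_tangentMap le_rfl
  have h2 : Continuous fun t : ℝ => (tangentBundleModelSpaceHomeomorph 𝓘(ℝ, ℝ)).symm (t, (1 : ℝ)) :=
    (Homeomorph.continuous _).comp (continuous_id.prodMk continuous_const)
  exact h1.comp h2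

variable [FiniteDimensional ℝ F]

/-- Multiplication by the complex number a + ib commutes with D/dt because J is parallel.
`covDerivAlong_eq_sum` does not require independent sections, so the doubled family of the `σ i` and
`J (σ i)` can be used. -/
lemma covDerivAlong_lincomb_J [ContMDiffVectorBundle 1 F E I] {cov : CovariantDerivative I F E}
    (S : HermitianStructure cov)
    {γ : ℝ → M} {t : ℝ} {ξ : ∀ s, E (γ s)}
    (hξ : MDifferentiableAt 𝓘(ℝ, ℝ) (I.prod 𝓘(ℝ, F)) (fun s => TotalSpace.mk' F (γ s) (ξ s)) t)
    (a b : ℝ) :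
    covDerivAlong cov γ (fun s => a • ξ s + b • S.J (γ s) (ξ s)) t =
      a • covDerivAlong cov γ ξ t + b • S.J (γ t) (covDerivAlong cov γ ξ t) := by
  have hγ : MDiffAt γ t := ((mdifferentiableAt_totalSpace I _).1 hξ).1
  obtain ⟨c, σ, hc, hσ, hsum⟩ := exists_eq_sum_along hξ
  have hJ : ∀ i, MDiffAt (T% (fun y => S.J y (σ i y))) (γ t) := fun i =>
    MDifferentiableAt.clm_bundle_apply
      ((S.smooth (γ t)).mdifferentiableAt (by simp)) (hσ i)
  have hd := fun i => (hc i).hasDerivAt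
  rw [covDerivAlong_eq_sum cov hγ hd hσ hsum,
    covDerivAlong_eq_sum cov hγ (ι := Fin (Module.finrank ℝ F) ⊕ Fin (Module.finrank ℝ F))
      (c := Sum.elim (fun i s => a * c i s) (fun i s => b * c i s))
      (c' := Sum.elim (fun i => a * deriv (c i) t) (fun i => b * deriv (c i) t))
      (σ := Sum.elim σ (fun i y => S.J y (σ i y))) ?_ ?_ ?_]
  · simp only [Fintype.sum_sum_type, Sum.elim_inl, Sum.elim_inr, Finset.smul_sum, map_sum, map_add,
      map_smul, smul_add, mul_smul, S.parallel _ _ (hσ _)]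
  · rintro (i | i)
    · exact (hd i).const_mul a
    · exact (hd i).const_mul b
  · rintro (i | i)
    · exact hσ i
    · exact hJ i
  · filter_upwards [hsum] with s hs
    simp only [hs, Fintype.sum_sum_type, Sum.elim_inl, Sum.elim_inr, Finset.smul_sum, map_sum,
      map_smul, mul_smul]

variable [FiniteDimensional ℝ EM] [IsManifold I ∞ M] [T2Space M] [ContMDiffVectorBundle ∞ F E I]

omit [FiniteDimensional ℝ F] in
/-- Near every point there is a frame, constant in a trivialization, of globally smooth sections. -/
lemma exists_smooth_frame {ι : Type*} (p : M) (b : ι → F) :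
    ∃ σ : ι → ∀ x, E x, (∀ i, ContMDiff I (I.prod 𝓘(ℝ, F)) ∞ (T% (σ i))) ∧
      ∀ᶠ x in 𝓝 p, ∀ i, σ i x = (trivializationAt F E p).symmL ℝ x (b i) := by
  set e := trivializationAt F E p
  have hb : e.baseSet ∈ 𝓝 p := e.open_baseSet.mem_nhds (mem_baseSet_trivializationAt F E p)
  obtain ⟨ψ, -, hψ⟩ := (SmoothBumpFunction.nhds_basis_tsupport (I := I) p).mem_iff.1 hb
  refine ⟨fun i x => ψ x • e.symmL ℝ x (b i), fun i => ?_, ?_⟩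
  · refine ContMDiffOn.smul_section_of_tsupport (ψ := ψ) ψ.contMDiff.contMDiffOn e.open_baseSet hψ ?_
    rw [e.contMDiffOn_section_baseSet_iff]
    refine (contMDiffOn_const (c := b i)).congr fun y hy => ?_
    rw [← e.continuousLinearMapAt_apply_of_mem (R := ℝ) hy, e.continuousLinearMapAt_symmL hy]
  · filter_upwards [ψ.eventuallyEq_one] with x hx i
    simp [hx, e]

omit [FiniteDimensional ℝ F] [FiniteDimensional ℝ EM] [T2Space M] [ContMDiffVectorBundle ∞ F E I] in
lemma contMDiff_cov {cov : CovariantDerivative I F E}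
    [CovariantDerivative.ContMDiffCovariantDerivative cov ∞] {σ : ∀ x, E x}
    (hσ : ContMDiff I (I.prod 𝓘(ℝ, F)) ∞ (T% σ)) :
    ContMDiff I (I.prod 𝓘(ℝ, EM →L[ℝ] F)) ∞
      (fun x => TotalSpace.mk' (EM →L[ℝ] F) (E := fun x => TangentSpace I x →L[ℝ] E x) x
        (cov σ x)) := by
  have h := (CovariantDerivative.ContMDiffCovariantDerivative.contMDiff (cov := cov)
    (k := ∞)).contMDiff (σ := σ) (by simpa using hσ.contMDiffOn)
  rwa [contMDiffOn_univ] at h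

/-- The covariant derivative of a smooth section along a smooth curve is continuous. -/
lemma continuous_covDerivAlong (cov : CovariantDerivative I F E)
    [CovariantDerivative.ContMDiffCovariantDerivative cov ∞] {γ : ℝ → M} {ξ : ∀ s, E (γ s)}
    (hξ : ContMDiff 𝓘(ℝ, ℝ) (I.prod 𝓘(ℝ, F)) ∞ (fun s => TotalSpace.mk' F (γ s) (ξ s))) :
    Continuous (fun s => TotalSpace.mk' F (γ s) (covDerivAlong cov γ ξ s)) := by
  have hγ : ContMDiff 𝓘(ℝ, ℝ) I ∞ γ := fun t => (contMDiffAt_totalSpace.1 (hξ t)).1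
  rw [continuous_iff_continuousAt]
  intro t
  set e := trivializationAt F E (γ t)
  have ht : γ t ∈ e.baseSet := mem_baseSet_trivializationAt F E (γ t)
  have hb : e.baseSet ∈ 𝓝 (γ t) := e.open_baseSet.mem_nhds ht
  let b := Module.finBasis ℝ F
  let p : Fin (Module.finrank ℝ F) → F →L[ℝ] ℝ := fun i =>
    LinearMap.toContinuousLinearMap (b.coord i)
  obtain ⟨σ, hσ, hσe⟩ := exists_smooth_frame (I := I) (E := E) (γ t) b
  let f : ℝ → F := fun s => (e ⟨γ s, ξ s⟩).2
  have hf : ContDiffAt ℝ ∞ f t := (contMDiffAt_totalSpace.1 (hξ t)).2.contDiffAt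
  have hf1 : ∀ᶠ s in 𝓝 t, ContDiffAt ℝ 1 f s := (hf.of_le (by simp)).eventually (by simp)
  have hexp : ∀ᶠ s in 𝓝 t, ξ s = ∑ i, p i (f s) • σ i (γ s) := by
    filter_upwards [hγ.continuous.continuousAt hb, hγ.continuous.continuousAt.eventually hσe]
      with s hs hs'
    simp only [hs', f]
    rw [← e.continuousLinearMapAt_apply_of_mem (R := ℝ) hs]
    exact eq_sum_coord e b hs (ξ s)
  -- The trivialization in the definition moves with s. Expressing the derivative near t in one
  -- fixed smooth frame makes every term visibly continuous.
  have hD : ∀ᶠ s in 𝓝 t, covDerivAlong cov γ ξ s = ∑ i, (p i (deriv f s) • σ i (γ s) +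
      p i (f s) • cov (σ i) (γ s) (velocity I γ s)) := by
    filter_upwards [hexp.eventually_nhds, hf1] with s hs hfs
    refine covDerivAlong_eq_sum cov (hγ.mdifferentiable (by simp) s) (fun i => ?_)
      (fun i => (hσ i).mdifferentiable (by simp) _) hs
    exact (p i).hasFDerivAt.comp_hasDerivAt s (hfs.differentiableAt one_ne_zero).hasDerivAt
  have hcovc : ∀ i, ContinuousAt
      (fun s => TotalSpace.mk' F (γ s) (cov (σ i) (γ s) (velocity I γ s))) t := fun i =>
    ContinuousAt.clm_bundle_apply (F₁ := EM) (E₁ := fun x : M => TangentSpace I x)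
      (((contMDiff_cov (cov := cov) (hσ i)).continuous.comp hγ.continuous).continuousAt)
      (continuous_velocity (hγ.of_le (by simp))).continuousAt
  have hσc : ∀ i, ContinuousAt (fun s => TotalSpace.mk' F (γ s) (σ i (γ s))) t := fun i =>
    ((hσ i).continuous.comp hγ.continuous).continuousAt
  have hdf : ContinuousAt (deriv f) t :=
    (hf.fderiv_right (m := 0) (by simp)).continuousAt.clm_apply continuousAt_const
  rw [FiberBundle.continuousAt_totalSpace]
  refine ⟨hγ.continuous.continuousAt, ?_⟩
  have hc : ContinuousAt (fun s => ∑ i, (p i (deriv f s) • (e ⟨γ s, σ i (γ s)⟩).2 +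
      p i (f s) • (e ⟨γ s, cov (σ i) (γ s) (velocity I γ s)⟩).2)) t := by
    refine tendsto_finsetSum _ fun i _ => ?_
    have h1 := ((FiberBundle.continuousAt_totalSpace F _).1 (hσc i)).2
    have h2 := ((FiberBundle.continuousAt_totalSpace F _).1 (hcovc i)).2
    exact (((p i).continuous.continuousAt.comp hdf).smul h1).add
      (((p i).continuous.continuousAt.comp hf.continuousAt).smul h2)
  refine hc.congr ?_
  filter_upwards [hD, hγ.continuous.continuousAt hb] with s hs hsb
  change _ = (e ⟨γ s, covDerivAlong cov γ ξ s⟩).2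
  rw [hs]
  simp only [← e.continuousLinearMapAt_apply_of_mem (R := ℝ) hsb, map_sum, map_add, map_smul]

end Smooth

/-! ### Local bounds for the connection form -/

lemma exists_bound_lipschitz {X W : Type*} [NormedAddCommGroup X] [NormedSpace ℝ X]
    [NormedAddCommGroup W] [NormedSpace ℝ W] {f : X → W} {x₀ : X} (hf : ContDiffAt ℝ 1 f x₀) :
    ∃ k : ℝ, 0 ≤ k ∧ ∃ t ∈ 𝓝 x₀, (∀ x ∈ t, ‖f x‖ ≤ k) ∧
      ∀ x ∈ t, ∀ y ∈ t, ‖f x - f y‖ ≤ k * ‖x - y‖ := by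
  obtain ⟨K, t, ht, hlip⟩ := hf.exists_lipschitzOnWith
  have hbd : ∀ᶠ y in 𝓝 x₀, ‖f y‖ < ‖f x₀‖ + 1 :=
    hf.continuousAt.norm.eventually (gt_mem_nhds (lt_add_one _))
  obtain ⟨U, hU, hUb⟩ := hbd.exists_mem
  refine ⟨K + (‖f x₀‖ + 1), by positivity, t ∩ U, inter_mem ht hU, fun x hx =>
    (hUb x hx.2).le.trans (by linarith [K.coe_nonneg]), fun x hx y hy => ?_⟩
  refine (hlip.norm_sub_le hx.1 hy.1).trans ?_
  gcongr
  exact le_add_of_nonneg_right (by positivity)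

lemma contDiffAt_sum_clm_comp {X V F W ι : Type*} [NormedAddCommGroup X] [NormedSpace ℝ X]
    [NormedAddCommGroup V] [NormedSpace ℝ V] [NormedAddCommGroup F] [NormedSpace ℝ F]
    [NormedAddCommGroup W] [NormedSpace ℝ W] [Fintype ι] (L : ι → F →L[ℝ] W)
    {B : ι → X → V →L[ℝ] F} {x₀ : X} (hB : ∀ i, ContDiffAt ℝ 1 (B i) x₀) :
    ContDiffAt ℝ 1 (fun y => ∑ i, (L i).comp (B i y)) x₀ :=
  ContDiffAt.sum fun i _ => contDiffAt_const.clm_comp (hB i)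

/-- A family of linear maps indexed by a basis, viewed as a bilinear map. -/
lemma exists_lipschitz_form {X V F ι : Type*} [NormedAddCommGroup X] [NormedSpace ℝ X]
    [NormedAddCommGroup V] [NormedSpace ℝ V] [NormedAddCommGroup F] [NormedSpace ℝ F]
    [FiniteDimensional ℝ F] [Fintype ι] [DecidableEq ι] (b : Module.Basis ι ℝ F)
    {B : ι → X → V →L[ℝ] F} {x₀ : X} (hB : ∀ i, ContDiffAt ℝ 1 (B i) x₀) :
    ∃ (Γ : X → V →L[ℝ] F →L[ℝ] F) (k : ℝ), 0 ≤ k ∧ ∃ t ∈ 𝓝 x₀,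
      (∀ x v i, Γ x v (b i) = B i x v) ∧
      (∀ x ∈ t, ‖Γ x‖ ≤ k) ∧ ∀ x ∈ t, ∀ y ∈ t, ‖Γ x - Γ y‖ ≤ k * ‖x - y‖ := by
  let q : ι → F →L[ℝ] ℝ := fun i => LinearMap.toContinuousLinearMap (b.coord i)
  obtain ⟨k, hk, t, ht, h1, h2⟩ := exists_bound_lipschitz
    (contDiffAt_sum_clm_comp (fun i => ContinuousLinearMap.smulRightL ℝ F F (q i)) hB)
  refine ⟨_, k, hk, t, ht, fun x v i => ?_, h1, h2⟩
  simp [q, Finsupp.single_apply]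

section Gauge

variable {EM : Type*} [NormedAddCommGroup EM] [NormedSpace ℝ EM]
  {HM : Type*} [TopologicalSpace HM] {I : ModelWithCorners ℝ EM HM}
  {M : Type*} [TopologicalSpace M] [ChartedSpace HM M] [IsManifold I ∞ M]
  [RiemannianBundle (fun x : M => TangentSpace I x)]
  {F : Type*} [NormedAddCommGroup F] [NormedSpace ℝ F] [FiniteDimensional ℝ F]
  {E : M → Type*} [TopologicalSpace (TotalSpace F E)]
  [∀ x, NormedAddCommGroup (E x)] [∀ x, InnerProductSpace ℝ (E x)]
  [FiberBundle F E] [VectorBundle ℝ F E]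

omit [IsManifold I ∞ M] [RiemannianBundle (fun x : M => TangentSpace I x)]
  [FiniteDimensional ℝ F] in
variable (I F E) in
lemma isContinuousRiemannianBundle_of_contMDiff [h : IsContMDiffRiemannianBundle I ∞ F E] :
    IsContinuousRiemannianBundle F E := by
  obtain ⟨g, hg, h⟩ := h.exists_contMDiff
  exact ⟨g, hg.continuous, h⟩

/-- The coordinates of a tangent vector in the chart at `p`. -/
def tangentCoord (I : ModelWithCorners ℝ EM HM) [IsManifold I ∞ M] (p x : M) :
    TangentSpace I x →L[ℝ] EM :=
  (trivializationAt EM (fun y : M => TangentSpace I y) p).continuousLinearMapAt ℝ x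

/-- A connection in local coordinates: on `U`, in the preferred trivialization and chart at `p`, the
connection form is `Γ`, and `k` bounds all the data. -/
structure ConnectionGauge (cov : CovariantDerivative I F E) (p : M) (U : Set M) (k : ℝ) where
  /-- the connection form in coordinates -/
  Γ : EM → EM →L[ℝ] F →L[ℝ] F
  /-- a frame of differentiable sections which is constant in the trivialization over `U` -/
  σ : Fin (Module.finrank ℝ F) → ∀ x, E x
  pos : 0 < k
  subset_baseSet : U ⊆ (trivializationAt F E p).baseSet
  subset_source : U ⊆ (chartAt HM p).source
  mdifferentiable : ∀ i x, MDiffAt (T% (σ i)) x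
  frame_eq : ∀ x ∈ U, ∀ i,
    σ i x = (trivializationAt F E p).symmL ℝ x (Module.finBasis ℝ F i)
  cov_eq : ∀ x ∈ U, ∀ i (v : TangentSpace I x),
    (trivializationAt F E p).continuousLinearMapAt ℝ x (cov (σ i) x v) =
      Γ (extChartAt I p x) (tangentCoord I p x v) (Module.finBasis ℝ F i)
  coord_le : ∀ x ∈ U, ‖(trivializationAt F E p).continuousLinearMapAt ℝ x‖ ≤ k
  symm_le : ∀ x ∈ U, ‖(trivializationAt F E p).symmL ℝ x‖ ≤ k
  tangent_le : ∀ x ∈ U, ‖tangentCoord I p x‖ ≤ k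
  form_le : ∀ x ∈ U, ‖Γ (extChartAt I p x)‖ ≤ k
  form_lip : ∀ x ∈ U, ∀ y ∈ U,
    ‖Γ (extChartAt I p x) - Γ (extChartAt I p y)‖ ≤ k * ‖extChartAt I p x - extChartAt I p y‖

variable [FiniteDimensional ℝ EM] [T2Space M] [I.Boundaryless] [ContMDiffVectorBundle ∞ F E I]
  [IsContMDiffRiemannianBundle I ∞ EM (fun x : M => TangentSpace I x)]
  [IsContMDiffRiemannianBundle I ∞ F E]

/-- The connection form is smooth in the chart, hence bounded and Lipschitz near p. The
trivializations of E and of the tangent bundle are bounded near p because the fibre metrics are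
continuous. -/
lemma exists_gauge (cov : CovariantDerivative I F E)
    [CovariantDerivative.ContMDiffCovariantDerivative cov ∞] (p : M) :
    ∃ U ∈ 𝓝 p, ∃ k, Nonempty (ConnectionGauge cov p U k) := by
  have := isContinuousRiemannianBundle_of_contMDiff I F E
  have := isContinuousRiemannianBundle_of_contMDiff I EM (fun x : M => TangentSpace I x)
  set e := trivializationAt F E p
  set eT := trivializationAt EM (fun y : M => TangentSpace I y) p with heT
  let b := Module.finBasis ℝ F
  obtain ⟨σ, hσ, hσe⟩ := exists_smooth_frame (I := I) (E := E) p b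
  let B : Fin (Module.finrank ℝ F) → M → EM →L[ℝ] F := fun i x =>
    ContinuousLinearMap.inCoordinates EM (fun y : M => TangentSpace I y) F E p x p x (cov (σ i) x)
  have hB : ∀ i, ContDiffAt ℝ 1 (fun y => B i ((extChartAt I p).symm y)) (extChartAt I p p) := by
    intro i
    have h1 : ContMDiffAt I 𝓘(ℝ, EM →L[ℝ] F) ∞ (B i) p :=
      ((contMDiffAt_hom_bundle _).1 (contMDiff_cov (cov := cov) (hσ i) p)).2
    have h3 : ContMDiffAt I 𝓘(ℝ, EM →L[ℝ] F) 1 (B i) p := h1.of_le (by simp)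
    have h2 := (contMDiffAt_iff.1 h3).2
    -- Without boundary the chart covers a full neighbourhood in `EM`, so differentiability within
    -- the range is ordinary differentiability.
    rw [I.range_eq_univ, contDiffWithinAt_univ] at h2
    exact h2
  obtain ⟨Γ, K, hK, t, ht, hΓ, hbd, hlip⟩ := exists_lipschitz_form b hB
  have hcont : ContinuousAt (extChartAt I p) p := continuousAt_extChartAt p
  obtain ⟨C₁, hC₁, h1⟩ := eventually_norm_trivializationAt_lt F E p
  obtain ⟨C₂, hC₂, h2⟩ := eventually_norm_symmL_trivializationAt_lt F E p
  obtain ⟨C₃, hC₃, h3⟩ := eventually_norm_trivializationAt_lt EM (fun x : M => TangentSpace I x) p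
  have he1 : ∀ᶠ x in 𝓝 p, x ∈ e.baseSet :=
    e.open_baseSet.mem_nhds (mem_baseSet_trivializationAt F E p)
  have he2 : ∀ᶠ x in 𝓝 p, x ∈ (chartAt HM p).source := chart_source_mem_nhds HM p
  have ht' : ∀ᶠ y in 𝓝 (extChartAt I p p), y ∈ t := ht
  have hall := (((((he1.and he2).and hσe).and (h1.and h2)).and h3).and
    (hcont.eventually ht'))
  obtain ⟨U, hU, hUp⟩ := hall.exists_mem
  set k : ℝ := C₁ + C₂ + C₃ + K
  refine ⟨U, hU, k, ⟨⟨Γ, σ, by positivity, fun x hx => (hUp x hx).1.1.1.1.1,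
    fun x hx => (hUp x hx).1.1.1.1.2, fun i x => (hσ i).mdifferentiable (by simp) x,
    fun x hx i => (hUp x hx).1.1.1.2 i, fun x hx i v => ?_,
    fun x hx => (hUp x hx).1.1.2.1.le.trans (by linarith),
    fun x hx => (hUp x hx).1.1.2.2.le.trans (by linarith),
    fun x hx => (hUp x hx).1.2.le.trans (by linarith),
    fun x hx => (hbd _ (hUp x hx).2).trans (by linarith), fun x hx y hy => ?_⟩⟩⟩
  · have hs := (hUp x hx).1.1.1.1.2
    have hxs : (extChartAt I p).symm (extChartAt I p x) = x :=
      (extChartAt I p).left_inv (by rwa [extChartAt_source])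
    rw [hΓ, hxs]
    have hT : x ∈ eT.baseSet := by
      rw [heT, TangentBundle.trivializationAt_baseSet]; exact hs
    change _ = e.continuousLinearMapAt ℝ x (cov (σ i) x (eT.symmL ℝ x (eT.continuousLinearMapAt ℝ x v)))
    rw [eT.symmL_continuousLinearMapAt hT]
  · refine (hlip _ (hUp x hx).2 _ (hUp y hy).2).trans ?_
    gcongr
    linarith

end Gauge

/-- A gauge controls Γ only at coordinates of points of U; its Lipschitz bound still makes Γ
continuous along a curve in U. -/
lemma continuous_of_norm_sub_le {X V V' W : Type*} [TopologicalSpace X]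
    [SeminormedAddCommGroup V] [NormedAddCommGroup V'] [NormedSpace ℝ V'] [NormedAddCommGroup W]
    [NormedSpace ℝ W] {f : X → V' →L[ℝ] W} {c : X → V} {k : ℝ} (hc : Continuous c)
    (h : ∀ s t, ‖f s - f t‖ ≤ k * ‖c s - c t‖) : Continuous f := by
  refine continuous_iff_continuousAt.2 fun t => ?_
  rw [ContinuousAt, tendsto_iff_norm_sub_tendsto_zero]
  have h0 : Tendsto (fun s => k * ‖c s - c t‖) (𝓝 t) (𝓝 0) := by
    have := ((tendsto_iff_norm_sub_tendsto_zero.1 (hc.tendsto t))).const_mul k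
    rwa [mul_zero] at this
  exact squeeze_zero (fun s => norm_nonneg _) (fun s => h s t) h0

/-! ### Parallel transport along short loops -/

section Parallel

variable {EM : Type*} [NormedAddCommGroup EM] [NormedSpace ℝ EM]
  {HM : Type*} [TopologicalSpace HM] {I : ModelWithCorners ℝ EM HM}
  {M : Type*} [TopologicalSpace M] [ChartedSpace HM M] [IsManifold I ∞ M]

lemma hasDerivAt_extChartAt_curve {γ : ℝ → M} {p : M} {t : ℝ} (hγ : MDiffAt γ t)
    (hp : γ t ∈ (chartAt HM p).source) :
    HasDerivAt (fun s => extChartAt I p (γ s)) (tangentCoord I p (γ t) (velocity I γ t)) t := by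
  have h := hasDerivAt_comp_curve (I := I) (mdifferentiableAt_extChartAt hp) hγ
  have e : tangentCoord I p (γ t) = mfderiv I 𝓘(ℝ, EM) (extChartAt I p) (γ t) :=
    TangentBundle.continuousLinearMapAt_trivializationAt hp
  rw [e]
  exact h

lemma continuous_tangentCoord_velocity {γ : ℝ → M} {p : M} (hγ : ContMDiff 𝓘(ℝ, ℝ) I ∞ γ)
    (hp : ∀ t, γ t ∈ (chartAt HM p).source) :
    Continuous fun t => tangentCoord I p (γ t) (velocity I γ t) := by
  set eT := trivializationAt EM (fun y : M => TangentSpace I y) p with heT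
  have hb : ∀ t, γ t ∈ eT.baseSet := fun t => by
    rw [heT, TangentBundle.trivializationAt_baseSet]; exact hp t
  have hv := continuous_velocity (hγ.of_le (n := ∞) (m := 1) (by simp))
  have h2 := eT.continuousOn.comp_continuous hv fun t => eT.mem_source.2 (hb t)
  refine h2.snd.congr fun t => ?_
  exact (eT.continuousLinearMapAt_apply_of_mem (R := ℝ) (hb t) _).symm

variable [RiemannianBundle (fun x : M => TangentSpace I x)]
  {F : Type*} [NormedAddCommGroup F] [NormedSpace ℝ F] [FiniteDimensional ℝ F]
  {E : M → Type*} [TopologicalSpace (TotalSpace F E)]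
  [∀ x, NormedAddCommGroup (E x)] [∀ x, InnerProductSpace ℝ (E x)]
  [FiberBundle F E] [VectorBundle ℝ F E] [FiniteDimensional ℝ EM]
  [IsContMDiffRiemannianBundle I ∞ EM (fun x : M => TangentSpace I x)]
  [ContMDiffVectorBundle 1 F E I]
  {cov : CovariantDerivative I F E} {p : M} {U : Set M} {k : ℝ}

omit [FiniteDimensional ℝ EM] in
lemma continuous_norm_velocity {γ : ℝ → M} (hγ : ContMDiff 𝓘(ℝ, ℝ) I ∞ γ) :
    Continuous fun t => ‖velocity I γ t‖ := by
  have := isContinuousRiemannianBundle_of_contMDiff I EM (fun x : M => TangentSpace I x)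
  have hv := continuous_velocity (hγ.of_le (n := ∞) (m := 1) (by simp))
  have h := (hv.inner_bundle hv).sqrt
  refine h.congr fun t => ?_
  rw [real_inner_self_eq_norm_sq, Real.sqrt_sq (norm_nonneg _)]

/-- Parallel transport around a short loop, with a quadratic bound on the holonomy. -/
lemma exists_parallel (G : ConnectionGauge cov p U k) {γ : ℝ → M}
    (hγ : ContMDiff 𝓘(ℝ, ℝ) I ∞ γ) (hU : ∀ t, γ t ∈ U) {T : ℝ} (hT : 0 ≤ T) (hper : γ T = γ 0)
    (hℓ : k * (k * ∫ t in (0 : ℝ)..T, ‖velocity I γ t‖) ≤ 1 / 2) (v : E (γ 0)) :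
    ∃ P : ∀ t, E (γ t), P 0 = v ∧
      (∀ t ∈ Icc 0 T, MDifferentiableAt 𝓘(ℝ, ℝ) (I.prod 𝓘(ℝ, F))
        (fun s => TotalSpace.mk' F (γ s) (P s)) t ∧ covDerivAlong cov γ P t = 0) ∧
      ‖(trivializationAt F E p).continuousLinearMapAt ℝ (γ T) (P T) -
        (trivializationAt F E p).continuousLinearMapAt ℝ (γ 0) v‖ ≤
        (2 * k + 2 * k ^ 2) * (k * ∫ t in (0 : ℝ)..T, ‖velocity I γ t‖) ^ 2 * (k * ‖v‖) := by
  set e := trivializationAt F E p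
  have hb : ∀ t, γ t ∈ e.baseSet := fun t => G.subset_baseSet (hU t)
  have hs : ∀ t, γ t ∈ (chartAt HM p).source := fun t => G.subset_source (hU t)
  have hγd : ∀ t, MDiffAt γ t := fun t => hγ.mdifferentiable (by simp) t
  set c : ℝ → EM := fun t => extChartAt I p (γ t) with hcdef
  set c' : ℝ → EM := fun t => tangentCoord I p (γ t) (velocity I γ t)
  have hc : ∀ t, HasDerivAt c (c' t) t := fun t => hasDerivAt_extChartAt_curve (hγd t) (hs t)
  have hc' : Continuous c' := continuous_tangentCoord_velocity hγ hs
  have hcc : Continuous c := continuous_iff_continuousAt.2 fun t => (hc t).continuousAt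
  have hΓc : Continuous fun t => G.Γ (c t) :=
    continuous_of_norm_sub_le hcc fun s t => G.form_lip _ (hU s) _ (hU t)
  have hvc := continuous_norm_velocity hγ
  have hc'le : ∀ t, ‖c' t‖ ≤ k * ‖velocity I γ t‖ := fun t =>
    ((tangentCoord I p (γ t)).le_opNorm _).trans
      (mul_le_mul_of_nonneg_right (G.tangent_le _ (hU t)) (norm_nonneg _))
  have hint' : ∫ t in (0 : ℝ)..T, ‖c' t‖ ≤ k * ∫ t in (0 : ℝ)..T, ‖velocity I γ t‖ := by
    rw [← intervalIntegral.integral_const_mul]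
    exact intervalIntegral.integral_mono_on hT (hc'.norm.intervalIntegrable _ _)
      ((continuous_const.mul hvc).intervalIntegrable _ _) fun t _ => hc'le t
  have hint0 : 0 ≤ ∫ t in (0 : ℝ)..T, ‖c' t‖ :=
    intervalIntegral.integral_nonneg hT fun t _ => norm_nonneg _
  have ha : Continuous fun t => G.Γ (c t) (c' t) := hΓc.clm_apply hc'
  have hint : ∫ t in (0 : ℝ)..T, ‖G.Γ (c t) (c' t)‖ ≤ 1 / 2 := by
    refine le_trans ?_ ((mul_le_mul_of_nonneg_left hint' G.pos.le).trans hℓ)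
    rw [← intervalIntegral.integral_const_mul]
    refine intervalIntegral.integral_mono_on hT (ha.norm.intervalIntegrable _ _)
      ((continuous_const.mul hc'.norm).intervalIntegrable _ _) fun t _ => ?_
    exact ((G.Γ (c t)).le_opNorm _).trans
      (mul_le_mul_of_nonneg_right (G.form_le _ (hU t)) (norm_nonneg _))
  obtain ⟨u, hu0, hu⟩ := exists_linear_ode ha hT hint (e.continuousLinearMapAt ℝ (γ 0) v)
  let b := Module.finBasis ℝ F
  let q : Fin (Module.finrank ℝ F) → F →L[ℝ] ℝ := fun i =>
    LinearMap.toContinuousLinearMap (b.coord i)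
  have hq : ∀ w, ∑ i, q i w • b i = w := fun w => b.sum_repr w
  have hP : ∀ s, e.symmL ℝ (γ s) (u s) = ∑ i, q i (u s) • G.σ i (γ s) := fun s => by
    conv_lhs => rw [← hq (u s)]
    simp only [map_sum, map_smul, G.frame_eq _ (hU s)]
    rfl
  refine ⟨fun s => e.symmL ℝ (γ s) (u s), ?_, fun t ht => ⟨?_, ?_⟩, ?_⟩
  · simp only [hu0]
    exact e.symmL_continuousLinearMapAt (hb 0) v
  · exact mdifferentiableAt_sum_along (hγd t)
      (fun i => ((q i).hasFDerivAt.comp_hasDerivAt t (hu t ht).1).differentiableAt)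
      (fun i => G.mdifferentiable i _) (Eventually.of_forall hP)
  · rw [covDerivAlong_eq_sum cov (hγd t)
      (fun i => (q i).hasFDerivAt.comp_hasDerivAt t (hu t ht).1)
      (fun i => G.mdifferentiable i _) (Eventually.of_forall hP)]
    set X : E (γ t) := _
    change X = 0
    -- In coordinates the covariant derivative is u' + Γ(c')u, which vanishes by the choice of u.
    have hX : e.continuousLinearMapAt ℝ (γ t) X = 0 := by
      have e1 : ∀ i, e.continuousLinearMapAt ℝ (γ t) (G.σ i (γ t)) = b i := fun i =>
        (congrArg _ (G.frame_eq _ (hU t) i)).trans (e.continuousLinearMapAt_symmL (hb t) _)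
      have e2 : ∀ i, e.continuousLinearMapAt ℝ (γ t) (cov (G.σ i) (γ t) (velocity I γ t)) =
          G.Γ (c t) (c' t) (b i) := fun i => G.cov_eq _ (hU t) i _
      have e3 : e.continuousLinearMapAt ℝ (γ t) X =
          ∑ i, (q i (-(G.Γ (c t) (c' t) (u t))) • b i + q i (u t) • G.Γ (c t) (c' t) (b i)) := by
        simp only [X, map_sum, map_add, map_smul, e1, e2]
        rfl
      have e4 : ∑ i, q i (u t) • G.Γ (c t) (c' t) (b i) = G.Γ (c t) (c' t) (u t) := by
        conv_rhs => rw [← hq (u t)]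
        simp only [map_sum, map_smul]
      rw [e3, Finset.sum_add_distrib, e4, hq, neg_add_cancel]
    rw [← e.symmL_continuousLinearMapAt (R := ℝ) (hb t) X, hX, map_zero]
  · change ‖e.continuousLinearMapAt ℝ (γ T) (e.symmL ℝ (γ T) (u T)) - _‖ ≤ _
    rw [e.continuousLinearMapAt_symmL (R := ℝ) (hb T)]
    have hk := G.pos.le
    have h := norm_holonomy_sub_le (s := extChartAt I p '' U) G.pos.le
      (by rintro _ ⟨x, hx, rfl⟩; exact G.form_le x hx)
      (by rintro _ ⟨x, hx, rfl⟩ _ ⟨y, hy, rfl⟩; exact G.form_lip x hx y hy) hT hc hc'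
      (fun t => mem_image_of_mem _ (hU t)) (by simp only [hcdef, hper]) hΓc hu0 hu
    refine h.trans ?_
    have h3 : ‖e.continuousLinearMapAt ℝ (γ 0) v‖ ≤ k * ‖v‖ :=
      ((e.continuousLinearMapAt ℝ (γ 0)).le_opNorm _).trans
        (mul_le_mul_of_nonneg_right (G.coord_le _ (hU 0)) (norm_nonneg _))
    gcongr

end Parallel

/-! ### Parallel orthonormal frames -/

section Frame

/-- Two orthonormal bases of the same space which are close define an isometry close to the
identity. -/
lemma exists_isometry_near_id {V ι : Type*} [NormedAddCommGroup V] [InnerProductSpace ℝ V]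
    [Fintype ι] (B B' : OrthonormalBasis ι ℝ V) {ε : ℝ} (hε : ∀ i, ‖B' i - B i‖ ≤ ε) :
    ∃ G : EuclideanSpace ℝ ι ≃ₗᵢ[ℝ] EuclideanSpace ℝ ι,
      (∀ v, ‖G v - v‖ ≤ Fintype.card ι * ε * ‖v‖) ∧ ∀ w, B'.repr w = G (B.repr w) := by
  refine ⟨B.repr.symm.trans B'.repr, fun v => ?_, fun w => by simp⟩
  have h1 : (B.repr.symm.trans B'.repr) v - v = B'.repr (B.repr.symm v - B'.repr.symm v) := by
    simp
  rw [h1, LinearIsometryEquiv.norm_map, ← B.sum_repr_symm, ← B'.sum_repr_symm,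
    ← Finset.sum_sub_distrib]
  refine (norm_sum_le _ _).trans ?_
  calc ∑ i, ‖v i • B i - v i • B' i‖ ≤ ∑ _i : ι, ‖v‖ * ε := by
        refine Finset.sum_le_sum fun i _ => ?_
        rw [← smul_sub, norm_smul, norm_sub_rev]
        exact mul_le_mul (PiLp.norm_apply_le v i) (hε i) (norm_nonneg _) (norm_nonneg _)
    _ = Fintype.card ι * ε * ‖v‖ := by
        rw [Finset.sum_const, Finset.card_univ, nsmul_eq_mul]; ring

variable {EM : Type*} [NormedAddCommGroup EM] [NormedSpace ℝ EM] [FiniteDimensional ℝ EM]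
  {HM : Type*} [TopologicalSpace HM] {I : ModelWithCorners ℝ EM HM}
  {M : Type*} [TopologicalSpace M] [ChartedSpace HM M] [IsManifold I ∞ M]
  [RiemannianBundle (fun x : M => TangentSpace I x)]
  [IsContMDiffRiemannianBundle I ∞ EM (fun x : M => TangentSpace I x)]
  {F : Type*} [NormedAddCommGroup F] [NormedSpace ℝ F] [FiniteDimensional ℝ F]
  {E : M → Type*} [TopologicalSpace (TotalSpace F E)]
  [∀ x, NormedAddCommGroup (E x)] [∀ x, InnerProductSpace ℝ (E x)]
  [FiberBundle F E] [VectorBundle ℝ F E]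
  {cov : CovariantDerivative I F E} {p : M} {U : Set M} {k : ℝ}

omit [FiniteDimensional ℝ F] in
variable (F) in
lemma finrank_fiber (x : M) : Module.finrank ℝ (E x) = Module.finrank ℝ F :=
  ((trivializationAt F E x).continuousLinearEquivAt ℝ x
    (mem_baseSet_trivializationAt F E x)).toLinearEquiv.finrank_eq

variable (F E) in
include F in
lemma finiteDimensional_fiber (x : M) : FiniteDimensional ℝ (E x) :=
  ((trivializationAt F E x).continuousLinearEquivAt ℝ x
    (mem_baseSet_trivializationAt F E x)).toLinearEquiv.symm.finiteDimensional

variable [ContMDiffVectorBundle 1 F E I] [IsContMDiffRiemannianBundle I 1 F E]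

/-- Along a short loop there is a parallel orthonormal frame, which closes up to second order. -/
lemma exists_parallel_frame (hcov : cov.IsMetricCompatible) (G : ConnectionGauge cov p U k)
    {γ : ℝ → M} (hγ : ContMDiff 𝓘(ℝ, ℝ) I ∞ γ) (hU : ∀ t, γ t ∈ U) {T : ℝ} (hT : 0 ≤ T)
    (hper : γ T = γ 0) (hℓ : k * (k * ∫ t in (0 : ℝ)..T, ‖velocity I γ t‖) ≤ 1 / 2) :
    ∃ P : Fin (Module.finrank ℝ F) → ∀ t, E (γ t),
      (∀ i, ∀ t ∈ Icc 0 T, MDifferentiableAt 𝓘(ℝ, ℝ) (I.prod 𝓘(ℝ, F))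
        (fun s => TotalSpace.mk' F (γ s) (P i s)) t ∧ covDerivAlong cov γ (P i) t = 0) ∧
      (∀ t ∈ Icc 0 T, ∃ B : OrthonormalBasis (Fin (Module.finrank ℝ F)) ℝ (E (γ t)),
        ∀ i, B i = P i t) ∧
      ∀ i, ‖(trivializationAt F E p).continuousLinearMapAt ℝ (γ T) (P i T) -
        (trivializationAt F E p).continuousLinearMapAt ℝ (γ 0) (P i 0)‖ ≤
        (2 * k + 2 * k ^ 2) * (k * ∫ t in (0 : ℝ)..T, ‖velocity I γ t‖) ^ 2 * k := by
  have := finiteDimensional_fiber F E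
  let β := (stdOrthonormalBasis ℝ (E (γ 0))).reindex (finCongr (finrank_fiber F (γ 0)))
  choose P hP0 hP hPT using fun i => exists_parallel G hγ hU hT hper hℓ (β i)
  refine ⟨P, hP, fun t ht => ?_, fun i => ?_⟩
  -- By metric compatibility the inner products of parallel sections have zero derivative, so
  -- orthonormality at time 0 persists.
  · have hin : ∀ i j, inner ℝ (P i t) (P j t) = inner ℝ (β i) (β j) := fun i j => by
      have hd : ∀ s ∈ Icc 0 T, HasDerivAt (fun s => inner ℝ (P i s) (P j s)) 0 s := fun s hs => by
        have := hasDerivAt_inner_along hcov (hP i s hs).1 (hP j s hs).1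
        rw [(hP i s hs).2, (hP j s hs).2] at this
        simpa using this
      have := constant_of_has_deriv_right_zero (fun s hs => (hd s hs).continuousAt.continuousWithinAt)
        (fun s hs => (hd s (Ico_subset_Icc_self hs)).hasDerivWithinAt) t ht
      rw [this, hP0, hP0]
    have hon : Orthonormal ℝ fun i => P i t := by
      rw [orthonormal_iff_ite]
      intro i j
      rw [hin, orthonormal_iff_ite.1 β.orthonormal]
    refine ⟨OrthonormalBasis.mk hon (hon.linearIndependent.span_eq_top_of_card_eq_finrank' ?_).ge,
      fun i => by simp⟩
    rw [finrank_fiber F, Fintype.card_fin]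
  · have h := hPT i
    rwa [β.orthonormal.1 i, mul_one, ← hP0 i] at h

end Frame

lemma hasDerivAt_toLp {ι : Type*} [Fintype ι] {f : ι → ℝ → ℝ} {f' : ι → ℝ} {t : ℝ}
    (hf : ∀ i, HasDerivAt (f i) (f' i) t) :
    HasDerivAt (fun s => (WithLp.toLp 2 fun i => f i s : EuclideanSpace ℝ ι)) (WithLp.toLp 2 f') t :=
  (EuclideanSpace.equiv ι ℝ).symm.hasFDerivAt.comp_hasDerivAt t (hasDerivAt_pi.2 hf)

/-! ### The inequality for a loop inside one gauge -/

section GaugeInequality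

variable {EM : Type*} [NormedAddCommGroup EM] [NormedSpace ℝ EM]
  {HM : Type*} [TopologicalSpace HM] {I : ModelWithCorners ℝ EM HM}
  {M : Type*} [TopologicalSpace M] [ChartedSpace HM M]
  {F : Type*} [NormedAddCommGroup F] [NormedSpace ℝ F]
  {E : M → Type*} [TopologicalSpace (TotalSpace F E)]
  [∀ x, NormedAddCommGroup (E x)] [∀ x, InnerProductSpace ℝ (E x)]
  [FiberBundle F E] [VectorBundle ℝ F E]

lemma contMDiff_comp_exp {α : Circle → M} (hα : ContMDiff (𝓡 1) I ∞ α) :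
    ContMDiff 𝓘(ℝ, ℝ) I ∞ fun t => α (Circle.exp t) :=
  hα.comp contMDiff_circleExp

omit [∀ x, InnerProductSpace ℝ (E x)] [VectorBundle ℝ F E] in
lemma IsSmoothSectionAlong.comp_exp {α : Circle → M} {ξ : ∀ z, E (α z)}
    (hξ : IsSmoothSectionAlong I F α ξ) :
    ContMDiff 𝓘(ℝ, ℝ) (I.prod 𝓘(ℝ, F)) ∞
      fun t => TotalSpace.mk' F (α (Circle.exp t)) (ξ (Circle.exp t)) :=
  ContMDiff.comp hξ contMDiff_circleExp

/-- The holonomy of an orthonormal frame, as an isometry close to the identity. -/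
lemma exists_holonomy {Z ι : Type*} [Fintype ι] {α : Z → M} {z z' : Z} (h : z = z')
    (B : OrthonormalBasis ι ℝ (E (α z))) (B' : OrthonormalBasis ι ℝ (E (α z')))
    (e : Trivialization F (π F E)) [MemTrivializationAtlas e] (hz : α z ∈ e.baseSet) {k ε : ℝ}
    (hk : ‖e.symmL ℝ (α z)‖ ≤ k)
    (hε : ∀ i, ‖e.continuousLinearMapAt ℝ (α z') (B' i) -
      e.continuousLinearMapAt ℝ (α z) (B i)‖ ≤ ε) :
    ∃ G : EuclideanSpace ℝ ι ≃ₗᵢ[ℝ] EuclideanSpace ℝ ι,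
      (∀ v, ‖G v - v‖ ≤ Fintype.card ι * (k * ε) * ‖v‖) ∧
      ∀ ξ : ∀ z, E (α z), B'.repr (ξ z') = G (B.repr (ξ z)) := by
  -- The fibres over `α z` and `α z'` are different types until the points are identified. Keeping z
  -- and z' arbitrary permits this substitution, which is not available for the concrete points exp
  -- 0 and exp 2π.
  subst h
  have hk0 : 0 ≤ k := (norm_nonneg _).trans hk
  obtain ⟨G, hG, hG'⟩ := exists_isometry_near_id B B' (ε := k * ε) fun i => by
    rw [← e.symmL_continuousLinearMapAt (R := ℝ) hz (B' i - B i), map_sub]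
    exact ((e.symmL ℝ (α z)).le_opNorm _).trans (mul_le_mul hk (hε i) (norm_nonneg _) hk0)
  exact ⟨G, hG, fun ξ => hG' _⟩

variable [IsManifold I ∞ M] [RiemannianBundle (fun x : M => TangentSpace I x)]
  [FiniteDimensional ℝ EM] [T2Space M]
  [IsContMDiffRiemannianBundle I ∞ EM (fun x : M => TangentSpace I x)]
  [FiniteDimensional ℝ F] [ContMDiffVectorBundle ∞ F E I] [IsContMDiffRiemannianBundle I ∞ F E]
  {cov : CovariantDerivative I F E} [CovariantDerivative.ContMDiffCovariantDerivative cov ∞]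
  {p : M} {U : Set M} {k : ℝ}

/-- Coordinates in the parallel orthonormal frame preserve inner products and turn ∇_θ into d/dθ, so
this is `twisted_inequality`, with ε the rank times the holonomy bound. -/
lemma gauge_inequality (hcov : cov.IsMetricCompatible) (G : ConnectionGauge cov p U k)
    {α : Circle → M} (hα : ContMDiff (𝓡 1) I ∞ α) (hU : ∀ z, α z ∈ U)
    (hℓ : k * (k * speedL1 I α) ≤ 1 / 2) {ξ ζ : ∀ z, E (α z)}
    (hξ : IsSmoothSectionAlong I F α ξ) (hζ : IsSmoothSectionAlong I F α ζ) :
    |∫ θ in (0 : ℝ)..(2 * Real.pi), inner ℝ (covDerivLoop cov α ξ θ) (ζ (Circle.exp θ))| ≤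
      normL2 α (covDerivLoop cov α ξ) * normL2 α (covDerivLoop cov α ζ) +
        3 * (Module.finrank ℝ F * (k * ((2 * k + 2 * k ^ 2) * (k * speedL1 I α) ^ 2 * k))) *
          normW21 cov α ξ * normL2 α (fun θ => ζ (Circle.exp θ)) := by
  have := isContinuousRiemannianBundle_of_contMDiff I F E
  have hT : (0 : ℝ) ≤ 2 * Real.pi := by positivity
  set γ : ℝ → M := fun t => α (Circle.exp t) with hγdef
  have hγ : ContMDiff 𝓘(ℝ, ℝ) I ∞ γ := contMDiff_comp_exp hα
  -- The frame lives on [0, 2π], not on the circle: `P i` at 0 and at 2π may differ, and comparing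
  -- these two bases of one fibre yields the isometry g.
  have hz : Circle.exp 0 = Circle.exp (2 * Real.pi) := by simp
  have hper : γ (2 * Real.pi) = γ 0 := congrArg α hz.symm
  obtain ⟨P, hP, hB, hPT⟩ := exists_parallel_frame hcov G hγ (fun t => hU _) hT hper hℓ
  choose B hBP using hB
  let X : (∀ t, E (γ t)) → ℝ → EuclideanSpace ℝ (Fin (Module.finrank ℝ F)) := fun η t =>
    WithLp.toLp 2 fun i => inner ℝ (P i t) (η t)
  have hX : ∀ η t (ht : t ∈ Icc 0 (2 * Real.pi)), X η t = (B t ht).repr (η t) := fun η t ht => by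
    ext i
    rw [OrthonormalBasis.repr_apply_apply, hBP]
  have hXn : ∀ η, l2 (X η) = normL2 α η := fun η => by
    unfold l2 normL2
    congr 1
    refine intervalIntegral.integral_congr fun t ht => ?_
    rw [uIcc_of_le hT] at ht
    simp only [hX η t ht, LinearIsometryEquiv.norm_map]
  have hXd : ∀ η : ∀ t, E (γ t), ContMDiff 𝓘(ℝ, ℝ) (I.prod 𝓘(ℝ, F)) ∞
      (fun t => TotalSpace.mk' F (γ t) (η t)) → ∀ t ∈ Icc 0 (2 * Real.pi),
      HasDerivAt (X η) (X (covDerivAlong cov γ η) t) t := fun η hη t ht => by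
    refine hasDerivAt_toLp fun i => ?_
    have := hasDerivAt_inner_along hcov (hP i t ht).1 (hη.mdifferentiable (by simp) t)
    rwa [(hP i t ht).2, inner_zero_left, zero_add] at this
  have hXc : ∀ η : ∀ t, E (γ t), ContMDiff 𝓘(ℝ, ℝ) (I.prod 𝓘(ℝ, F)) ∞
      (fun t => TotalSpace.mk' F (γ t) (η t)) →
      ContinuousOn (X (covDerivAlong cov γ η)) (Icc 0 (2 * Real.pi)) := fun η hη t ht => by
    refine ContinuousAt.continuousWithinAt ?_
    refine (PiLp.continuous_toLp 2 _).continuousAt.comp (continuousAt_pi.2 fun i => ?_)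
    exact (hP i t ht).1.continuousAt.inner_bundle
      (continuous_covDerivAlong cov hη).continuousAt
  have h0 : (0 : ℝ) ∈ Icc 0 (2 * Real.pi) := ⟨le_rfl, hT⟩
  have h1 : (2 * Real.pi : ℝ) ∈ Icc 0 (2 * Real.pi) := ⟨hT, le_rfl⟩
  obtain ⟨g, hg, hgX⟩ := exists_holonomy hz (B 0 h0) (B _ h1) (trivializationAt F E p)
    (G.subset_baseSet (hU _)) (G.symm_le _ (hU _)) (fun i => by rw [hBP, hBP]; exact hPT i)
  rw [Fintype.card_fin] at hg
  have hper' : ∀ η : ∀ z, E (α z), X (fun t => η (Circle.exp t)) (2 * Real.pi) =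
      g (X (fun t => η (Circle.exp t)) 0) := fun η => by
    rw [hX (fun t => η (Circle.exp t)) _ h0, hX (fun t => η (Circle.exp t)) _ h1]
    exact hgX η
  have hk := G.pos
  have hmain := twisted_inequality (hXd _ hξ.comp_exp) (hXc _ hξ.comp_exp) (hXd _ hζ.comp_exp)
    (hXc _ hζ.comp_exp) g (by positivity) hg
    (hper' ξ) (hper' ζ)
  simp only [hXn] at hmain
  refine le_trans (le_of_eq ?_) hmain
  congr 1
  refine intervalIntegral.integral_congr fun t ht => ?_
  rw [uIcc_of_le hT] at ht
  simp only [hX _ t ht, LinearIsometryEquiv.inner_map_map]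
  rfl

end GaugeInequality

lemma normL2_nonneg {M : Type*} {E : M → Type*} [∀ x, NormedAddCommGroup (E x)] (α : Circle → M)
    (ξ : ∀ θ : ℝ, E (α (Circle.exp θ))) : 0 ≤ normL2 α ξ :=
  Real.sqrt_nonneg _

lemma continuous_norm_section {M F : Type*} [TopologicalSpace M] [NormedAddCommGroup F]
    [NormedSpace ℝ F] {E : M → Type*} [TopologicalSpace (TotalSpace F E)]
    [∀ x, NormedAddCommGroup (E x)] [∀ x, InnerProductSpace ℝ (E x)] [FiberBundle F E]
    [VectorBundle ℝ F E] [IsContinuousRiemannianBundle F E] {X : Type*} [TopologicalSpace X]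
    {γ : X → M} {ξ : ∀ t, E (γ t)} (hξ : Continuous fun t => TotalSpace.mk' F (γ t) (ξ t)) :
    Continuous fun t => ‖ξ t‖ := by
  refine (hξ.inner_bundle hξ).sqrt.congr fun t => ?_
  rw [real_inner_self_eq_norm_sq, Real.sqrt_sq (norm_nonneg _)]

/-! ### Compactness, and short versus long loops -/

section Global

variable {EM : Type*} [NormedAddCommGroup EM] [NormedSpace ℝ EM]
  {HM : Type*} [TopologicalSpace HM] {I : ModelWithCorners ℝ EM HM}
  {M : Type*} [TopologicalSpace M] [ChartedSpace HM M] [IsManifold I ∞ M]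
  [RiemannianBundle (fun x : M => TangentSpace I x)]
  [IsContMDiffRiemannianBundle I ∞ EM (fun x : M => TangentSpace I x)]

omit [IsManifold I ∞ M] [IsContMDiffRiemannianBundle I ∞ EM (fun x : M => TangentSpace I x)] in
lemma speedL1_nonneg (α : Circle → M) : 0 ≤ speedL1 I α :=
  intervalIntegral.integral_nonneg (by positivity) fun _ _ => norm_nonneg _

lemma speedL1_sq_le {α : Circle → M} (hα : ContMDiff (𝓡 1) I ∞ α) :
    speedL1 I α ^ 2 ≤ 2 * Real.pi * speedL2 I α ^ 2 := by
  have hc := continuous_norm_velocity (contMDiff_comp_exp hα)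
  have h := integral_norm_le_l2 hc.continuousOn
  have h1 : (∫ t in (0 : ℝ)..(2 * Real.pi), ‖‖velocity I (fun t => α (Circle.exp t)) t‖‖) =
      speedL1 I α := by simp [speedL1]
  have h2 : l2 (fun t => ‖velocity I (fun t => α (Circle.exp t)) t‖) = speedL2 I α := by
    simp [l2, speedL2]
  rw [h1, h2] at h
  calc speedL1 I α ^ 2 ≤ (√(2 * Real.pi) * speedL2 I α) ^ 2 :=
        pow_le_pow_left₀ (speedL1_nonneg α) h 2
    _ = 2 * Real.pi * speedL2 I α ^ 2 := by
        rw [mul_pow, Real.sq_sqrt (by positivity)]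

lemma pathELength_exp {α : Circle → M} (hα : ContMDiff (𝓡 1) I ∞ α) :
    Manifold.pathELength I (fun t => α (Circle.exp t)) 0 (2 * Real.pi) =
      ENNReal.ofReal (speedL1 I α) := by
  have hc := continuous_norm_velocity (contMDiff_comp_exp hα)
  rw [Manifold.pathELength_eq_lintegral_mfderiv_Icc, speedL1,
    intervalIntegral.integral_of_le (by positivity), ← integral_Icc_eq_integral_Ioc,
    ofReal_integral_eq_lintegral_ofReal (hc.continuousOn.integrableOn_Icc)
      (Eventually.of_forall fun t => norm_nonneg _)]
  refine lintegral_congr fun t => ?_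
  exact (ofReal_norm _).symm

/-- A short loop starting near `p` stays near `p`. -/
lemma exists_stay [FiniteDimensional ℝ EM] [T2Space M] (p : M) {U : Set M} (hU : U ∈ 𝓝 p) :
    ∃ V ∈ 𝓝 p, ∃ δ : ℝ, 0 < δ ∧ ∀ α : Circle → M, ContMDiff (𝓡 1) I ∞ α → α 1 ∈ V →
      speedL1 I α < δ → ∀ z, α z ∈ U := by
  have := isContinuousRiemannianBundle_of_contMDiff I EM (fun x : M => TangentSpace I x)
  have := Manifold.locallyCompact_of_finiteDimensional (M := M) I
  obtain ⟨c, hc, hcU⟩ := setOfPred_riemannianEDist_lt_subset_nhds I hU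
  -- A ball of radius c about p lies in U. Half the radius is spent on the starting point, half on
  -- the length of the loop.
  refine ⟨_, eventually_riemannianEDist_lt I p (c := (c / 2 : NNReal)) (by positivity),
    (c / 2 : NNReal), by positivity, fun α hα h1 hδ z => hcU ?_⟩
  obtain ⟨t, ht, htz⟩ := Circle.periodic_exp.exists_mem_Ico₀ Real.two_pi_pos (z : ℂ).arg
  rw [Circle.exp_arg] at htz
  set γ : ℝ → M := fun t => α (Circle.exp t) with hγdef
  have hγ : ContMDiff 𝓘(ℝ, ℝ) I ∞ γ := contMDiff_comp_exp hα
  have h2 : Manifold.riemannianEDist I (α 1) (α z) ≤ ENNReal.ofReal (speedL1 I α) := by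
    rw [← pathELength_exp hα]
    refine (Manifold.riemannianEDist_le_pathELength (γ := γ) (a := 0) (b := t)
      (hγ.of_le (by simp)).contMDiffOn (by simp [hγdef]) (by simp only [hγdef, htz]) ht.1).trans ?_
    exact Manifold.pathELength_mono le_rfl ht.2.le
  have h3 : ENNReal.ofReal (speedL1 I α) < (c / 2 : NNReal) := by
    rw [ENNReal.ofReal, ENNReal.coe_lt_coe, Real.toNNReal_lt_iff_lt_coe (speedL1_nonneg α)]
    exact hδ
  calc Manifold.riemannianEDist I p (α z) ≤
        Manifold.riemannianEDist I p (α 1) + Manifold.riemannianEDist I (α 1) (α z) :=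
        Manifold.riemannianEDist_triangle
    _ < (c / 2 : NNReal) + (c / 2 : NNReal) := ENNReal.add_lt_add h1 (h2.trans_lt h3)
    _ = c := by rw [← ENNReal.coe_add, add_halves]

variable [FiniteDimensional ℝ EM] [T2Space M] [I.Boundaryless]
  {F : Type*} [NormedAddCommGroup F] [NormedSpace ℝ F] [FiniteDimensional ℝ F]
  {E : M → Type*} [TopologicalSpace (TotalSpace F E)]
  [∀ x, NormedAddCommGroup (E x)] [∀ x, InnerProductSpace ℝ (E x)]
  [FiberBundle F E] [VectorBundle ℝ F E]
  [ContMDiffVectorBundle ∞ F E I] [IsContMDiffRiemannianBundle I ∞ F E]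
  {cov : CovariantDerivative I F E} [CovariantDerivative.ContMDiffCovariantDerivative cov ∞]

/-- Induction over compact sets. Only the base point α 1 is required to lie in K: a loop in a union
of two sets may lie in neither, but its base point lies in one of them. -/
lemma short_loop_inequality (hcov : cov.IsMetricCompatible) {K : Set M} (hK : IsCompact K) :
    ∃ δ : ℝ, 0 < δ ∧ ∃ C : ℝ, 0 ≤ C ∧ ∀ α : Circle → M, ContMDiff (𝓡 1) I ∞ α → α 1 ∈ K →
      speedL1 I α < δ → ∀ ξ ζ : ∀ z, E (α z),
        IsSmoothSectionAlong I F α ξ → IsSmoothSectionAlong I F α ζ →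
        |∫ θ in (0 : ℝ)..(2 * Real.pi), inner ℝ (covDerivLoop cov α ξ θ) (ζ (Circle.exp θ))| ≤
          normL2 α (covDerivLoop cov α ξ) * normL2 α (covDerivLoop cov α ζ) +
            C * speedL1 I α ^ 2 * normW21 cov α ξ * normL2 α (fun θ => ζ (Circle.exp θ)) := by
  refine hK.induction_on ⟨1, one_pos, 0, le_rfl, fun α _ h => h.elim⟩ ?_ ?_ ?_
  · rintro s t hst ⟨δ, hδ, C, hC, h⟩
    exact ⟨δ, hδ, C, hC, fun α hα h1 => h α hα (hst h1)⟩
  · rintro s t ⟨δ, hδ, C, hC, h⟩ ⟨δ', hδ', C', hC', h'⟩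
    refine ⟨min δ δ', lt_min hδ hδ', max C C', hC.trans (le_max_left _ _),
      fun α hα h1 hℓ ξ ζ hξ hζ => ?_⟩
    have hW : 0 ≤ normW21 cov α ξ := add_nonneg (normL2_nonneg _ _) (normL2_nonneg _ _)
    have hZ := normL2_nonneg α fun θ => ζ (Circle.exp θ)
    rcases h1 with h1 | h1
    · refine (h α hα h1 (hℓ.trans_le (min_le_left _ _)) ξ ζ hξ hζ).trans ?_
      gcongr
      exact le_max_left _ _
    · refine (h' α hα h1 (hℓ.trans_le (min_le_right _ _)) ξ ζ hξ hζ).trans ?_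
      gcongr
      exact le_max_right _ _
  · intro p _
    obtain ⟨U, hU, k, ⟨G⟩⟩ := exists_gauge cov p
    obtain ⟨V, hV, δ, hδ, hst⟩ := exists_stay (I := I) p hU
    have hk := G.pos
    -- The first bound keeps the loop in U, and the second gives k²ℓ ≤ 1/2, as parallel transport
    -- requires.
    refine ⟨V, mem_nhdsWithin_of_mem_nhds hV, min δ (1 / (2 * (k * k))), by positivity,
      3 * (Module.finrank ℝ F * (k * ((2 * k + 2 * k ^ 2) * k ^ 2 * k))), by positivity,
      fun α hα h1 hℓ ξ ζ hξ hζ => ?_⟩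
    have hℓ' : k * (k * speedL1 I α) ≤ 1 / 2 := by
      have h2 := (hℓ.trans_le (min_le_right _ _)).le
      rw [le_div_iff₀ (by positivity)] at h2
      linarith
    refine (gauge_inequality hcov G hα (hst α hα h1 (hℓ.trans_le (min_le_left _ _))) hℓ' hξ
      hζ).trans_eq ?_
    ring

omit [RiemannianBundle (fun x : M => TangentSpace I x)]
  [IsContMDiffRiemannianBundle I ∞ EM (fun x : M => TangentSpace I x)] [I.Boundaryless] in
lemma abs_integral_inner_le {α : Circle → M} {ξ ζ : ∀ z, E (α z)}
    (hξ : IsSmoothSectionAlong I F α ξ) (hζ : IsSmoothSectionAlong I F α ζ) :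
    |∫ θ in (0 : ℝ)..(2 * Real.pi), inner ℝ (covDerivLoop cov α ξ θ) (ζ (Circle.exp θ))| ≤
      normL2 α (covDerivLoop cov α ξ) * normL2 α (fun θ => ζ (Circle.exp θ)) := by
  have := isContinuousRiemannianBundle_of_contMDiff I F E
  have h1 := continuous_norm_section (continuous_covDerivAlong cov hξ.comp_exp)
  have h2 := continuous_norm_section hζ.comp_exp.continuous
  have h := integral_norm_mul_norm_le h1.continuousOn h2.continuousOn
  simp only [norm_norm] at h
  have e1 : ∀ η : ∀ t : ℝ, E (α (Circle.exp t)), l2 (fun t => ‖η t‖) = normL2 α η := fun η => by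
    simp [l2, normL2]
  rw [e1 (covDerivAlong cov _ _), e1] at h
  refine le_trans ?_ h
  rw [← Real.norm_eq_abs]
  exact intervalIntegral.norm_integral_le_of_norm_le Real.two_pi_pos.le
    (Eventually.of_forall fun t _ => norm_inner_le_norm (covDerivLoop cov α ξ t) _)
    ((h1.mul h2).intervalIntegrable _ _)

lemma loop_inequality (hcov : cov.IsMetricCompatible) {K : Set M} (hK : IsCompact K) :
    ∃ C : ℝ, 0 < C ∧ ∀ α : Circle → M, ContMDiff (𝓡 1) I ∞ α → range α ⊆ K →
      ∀ ξ ζ : ∀ z, E (α z), IsSmoothSectionAlong I F α ξ → IsSmoothSectionAlong I F α ζ →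
        |∫ θ in (0 : ℝ)..(2 * Real.pi), inner ℝ (covDerivLoop cov α ξ θ) (ζ (Circle.exp θ))| ≤
          normL2 α (covDerivLoop cov α ξ) * normL2 α (covDerivLoop cov α ζ) +
            C * min (speedL1 I α) (speedL2 I α ^ 2) * normW21 cov α ξ *
              normL2 α (fun θ => ζ (Circle.exp θ)) := by
  obtain ⟨δ, hδ, C, hC, h⟩ := short_loop_inequality hcov hK
  have hπ := Real.two_pi_pos
  -- A lower bound for the minimum on long loops: ℓ ≥ δ forces ‖dα‖₂² ≥ ℓ²/(2π) ≥ δ²/(2π).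
  set m := min δ (δ ^ 2 / (2 * Real.pi))
  have hm0 : 0 < m := lt_min hδ (by positivity)
  refine ⟨C * (δ + 2 * Real.pi) + 1 / m, by positivity, fun α hα hαK ξ ζ hξ hζ => ?_⟩
  have hℓ0 := speedL1_nonneg (I := I) α
  have hℓE := speedL1_sq_le hα
  set ℓ := speedL1 I α
  set Q := speedL2 I α ^ 2
  have hQ0 : 0 ≤ Q := sq_nonneg _
  have hξ0 := normL2_nonneg α fun θ => ξ (Circle.exp θ)
  have hDξ0 := normL2_nonneg α (covDerivLoop cov α ξ)
  have hDζ0 := normL2_nonneg α (covDerivLoop cov α ζ)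
  have hζ0 := normL2_nonneg α fun θ => ζ (Circle.exp θ)
  have hW : 0 ≤ normW21 cov α ξ := add_nonneg hξ0 hDξ0
  have hmin : 0 ≤ min ℓ Q := le_min hℓ0 hQ0
  rcases lt_or_ge ℓ δ with hℓ | hℓ
  · refine (h α hα (hαK ⟨1, rfl⟩) hℓ ξ ζ hξ hζ).trans ?_
    -- Short loops satisfy both ℓ² ≤ δℓ and ℓ² ≤ 2πQ; adding the two constants covers either value
    -- of the minimum.
    have h1 : ℓ ^ 2 ≤ (δ + 2 * Real.pi) * min ℓ Q := by
      rcases min_choice ℓ Q with h2 | h2 <;> rw [h2] <;> nlinarith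
    have h2 : C * ℓ ^ 2 ≤ (C * (δ + 2 * Real.pi) + 1 / m) * min ℓ Q := by
      have := mul_le_mul_of_nonneg_left h1 hC
      have h3 : 0 ≤ 1 / m * min ℓ Q := by positivity
      linarith
    gcongr
  · refine (abs_integral_inner_le hξ hζ).trans ?_
    have h1 : m ≤ min ℓ Q := by
      refine le_min ((min_le_left _ _).trans hℓ) ((min_le_right _ _).trans ?_)
      rw [div_le_iff₀ hπ]
      nlinarith
    have h2 : 1 ≤ (C * (δ + 2 * Real.pi) + 1 / m) * min ℓ Q := by
      have h3 : 1 ≤ 1 / m * min ℓ Q := by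
        rw [one_div, ← div_eq_inv_mul, le_div_iff₀ hm0, one_mul]; exact h1
      have h4 : 0 ≤ C * (δ + 2 * Real.pi) * min ℓ Q := by positivity
      linarith
    have h3 : normL2 α (covDerivLoop cov α ξ) ≤ normW21 cov α ξ := le_add_of_nonneg_left hξ0
    have h4 : 1 * (normW21 cov α ξ * normL2 α fun θ => ζ (Circle.exp θ)) ≤
        (C * (δ + 2 * Real.pi) + 1 / m) * min ℓ Q *
          (normW21 cov α ξ * normL2 α fun θ => ζ (Circle.exp θ)) := by gcongr
    have h5 := mul_le_mul_of_nonneg_right h3 hζ0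
    have h6 := mul_nonneg hDξ0 hDζ0
    linarith

end Global

/-! ### Reduction of the Hermitian case to the real case -/

section Complex

/-- The modulus of a complex number is the value of a real unit functional. -/
lemma exists_unit_norm_eq (z : ℂ) : ∃ a b : ℝ, a ^ 2 + b ^ 2 = 1 ∧ ‖z‖ = a * z.re + b * z.im := by
  have hz : z.re ^ 2 + z.im ^ 2 = ‖z‖ ^ 2 := by rw [Complex.sq_norm, Complex.normSq_apply]; ring
  rcases eq_or_ne z 0 with rfl | h
  · exact ⟨1, 0, by norm_num, by simp⟩
  · have hn : ‖z‖ ≠ 0 := norm_ne_zero_iff.2 h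
    refine ⟨z.re / ‖z‖, z.im / ‖z‖, ?_, ?_⟩
    · rw [div_pow, div_pow, ← add_div, hz, div_self (pow_ne_zero 2 hn)]
    · field_simp
      linarith

variable {EM : Type*} [NormedAddCommGroup EM] [NormedSpace ℝ EM]
  {HM : Type*} [TopologicalSpace HM] {I : ModelWithCorners ℝ EM HM}
  {M : Type*} [TopologicalSpace M] [ChartedSpace HM M]
  {F : Type*} [NormedAddCommGroup F] [NormedSpace ℝ F]
  {E : M → Type*} [TopologicalSpace (TotalSpace F E)]
  [∀ x, NormedAddCommGroup (E x)] [∀ x, InnerProductSpace ℝ (E x)]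
  [FiberBundle F E] [VectorBundle ℝ F E] {cov : CovariantDerivative I F E}

/-- Orthogonality and J² = -1 make J v perpendicular to v and of the same length, so unit complex
numbers act isometrically. -/
lemma HermitianStructure.norm_lincomb (S : HermitianStructure cov) {a b : ℝ}
    (hab : a ^ 2 + b ^ 2 = 1) (x : M) (v : E x) : ‖a • v + b • S.J x v‖ = ‖v‖ := by
  have h1 : inner ℝ v (S.J x v) = 0 := by
    have h2 := S.orthogonal x v (S.J x v)
    rw [S.sq, inner_neg_right, real_inner_comm] at h2
    linarith
  have h3 : ‖S.J x v‖ ^ 2 = ‖v‖ ^ 2 := by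
    rw [← real_inner_self_eq_norm_sq, S.orthogonal, real_inner_self_eq_norm_sq]
  refine (sq_eq_sq₀ (norm_nonneg _) (norm_nonneg _)).1 ?_
  rw [norm_add_sq_real, norm_smul, norm_smul, mul_pow, mul_pow, h3, real_inner_smul_left,
    real_inner_smul_right, h1, Real.norm_eq_abs, Real.norm_eq_abs, sq_abs, sq_abs, mul_zero,
    mul_zero, mul_zero, add_zero, ← add_mul, hab, one_mul]

lemma HermitianStructure.normL2_lincomb (S : HermitianStructure cov) {a b : ℝ}
    (hab : a ^ 2 + b ^ 2 = 1) (α : Circle → M) (ζ : ∀ θ : ℝ, E (α (Circle.exp θ))) :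
    normL2 α (fun θ => a • ζ θ + b • S.J _ (ζ θ)) = normL2 α ζ := by
  simp only [normL2, S.norm_lincomb hab]

lemma HermitianStructure.contMDiff_J (S : HermitianStructure cov) {α : Circle → M}
    {ζ : ∀ z, E (α z)} (hζ : IsSmoothSectionAlong I F α ζ) :
    IsSmoothSectionAlong I F α fun z => S.J (α z) (ζ z) := by
  intro z
  have hα : ContMDiffAt (𝓡 1) I ∞ α z := (contMDiffAt_totalSpace.1 (hζ z)).1
  exact ContMDiffAt.clm_bundle_apply (F₁ := F) (F₂ := F) ((S.smooth (α z)).comp z hα) (hζ z)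

variable [FiniteDimensional ℝ F] [FiniteDimensional ℝ EM] [IsManifold I ∞ M] [T2Space M]
  [ContMDiffVectorBundle ∞ F E I] [IsContMDiffRiemannianBundle I ∞ F E]
  [CovariantDerivative.ContMDiffCovariantDerivative cov ∞]

/-- The modulus of a Hermitian pairing is a real pairing with a rotated section. -/
lemma HermitianStructure.exists_norm_integral_herm_eq (S : HermitianStructure cov) {α : Circle → M}
    {ξ ζ : ∀ z, E (α z)} (hξ : IsSmoothSectionAlong I F α ξ) (hζ : IsSmoothSectionAlong I F α ζ) :
    ∃ a b : ℝ, a ^ 2 + b ^ 2 = 1 ∧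
      ‖∫ θ in (0 : ℝ)..(2 * Real.pi),
        S.herm (α (Circle.exp θ)) (covDerivLoop cov α ξ θ) (ζ (Circle.exp θ))‖ =
      ∫ θ in (0 : ℝ)..(2 * Real.pi), inner ℝ (covDerivLoop cov α ξ θ)
        (a • ζ (Circle.exp θ) + b • S.J _ (ζ (Circle.exp θ))) := by
  have := isContinuousRiemannianBundle_of_contMDiff I F E
  have hD := continuous_covDerivAlong cov hξ.comp_exp
  have h1 : Continuous fun θ => inner ℝ (covDerivLoop cov α ξ θ) (ζ (Circle.exp θ)) :=
    hD.inner_bundle hζ.comp_exp.continuous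
  have h2 : Continuous fun θ => inner ℝ (covDerivLoop cov α ξ θ) (S.J _ (ζ (Circle.exp θ))) :=
    hD.inner_bundle (S.contMDiff_J hζ).comp_exp.continuous
  have hh : Continuous fun θ =>
      S.herm (α (Circle.exp θ)) (covDerivLoop cov α ξ θ) (ζ (Circle.exp θ)) :=
    Complex.equivRealProdCLM.symm.continuous.comp (h1.prodMk h2)
  obtain ⟨a, b, hab, hz⟩ := exists_unit_norm_eq (∫ θ in (0 : ℝ)..(2 * Real.pi),
    S.herm (α (Circle.exp θ)) (covDerivLoop cov α ξ θ) (ζ (Circle.exp θ)))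
  refine ⟨a, b, hab, hz.trans ?_⟩
  have hre := Complex.reCLM.intervalIntegral_comp_comm (hh.intervalIntegrable (μ := volume) 0
    (2 * Real.pi))
  have him := Complex.imCLM.intervalIntegral_comp_comm (hh.intervalIntegrable (μ := volume) 0
    (2 * Real.pi))
  rw [Complex.reCLM_apply] at hre
  rw [Complex.imCLM_apply] at him
  rw [← hre, ← him, ← intervalIntegral.integral_const_mul, ← intervalIntegral.integral_const_mul,
    ← intervalIntegral.integral_add]
  · refine intervalIntegral.integral_congr fun θ _ => ?_
    simp only [inner_add_right, real_inner_smul_right]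
    rfl
  · exact (continuous_const.mul h1).intervalIntegrable _ _
  · exact (continuous_const.mul h2).intervalIntegrable _ _

variable [I.Boundaryless] [RiemannianBundle (fun x : M => TangentSpace I x)]
  [IsContMDiffRiemannianBundle I ∞ EM (fun x : M => TangentSpace I x)]

/-- The real inequality is applied to ξ and (a + bJ)ζ. Since a + bJ is isometric and commutes with
∇_θ, the right-hand side is that of ζ, and the real constant serves unchanged. -/
lemma hermitian_loop_inequality (hcov : cov.IsMetricCompatible) {K : Set M} (hK : IsCompact K)
    (S : HermitianStructure cov) :
    ∃ C : ℝ, 0 < C ∧ ∀ α : Circle → M, ContMDiff (𝓡 1) I ∞ α → range α ⊆ K →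
      ∀ ξ ζ : ∀ z, E (α z), IsSmoothSectionAlong I F α ξ → IsSmoothSectionAlong I F α ζ →
        ‖∫ θ in (0 : ℝ)..(2 * Real.pi),
            S.herm (α (Circle.exp θ)) (covDerivLoop cov α ξ θ) (ζ (Circle.exp θ))‖ ≤
          normL2 α (covDerivLoop cov α ξ) * normL2 α (covDerivLoop cov α ζ) +
            C * min (speedL1 I α) (speedL2 I α ^ 2) * normW21 cov α ξ *
              normL2 α (fun θ => ζ (Circle.exp θ)) := by
  obtain ⟨C, hC, h⟩ := loop_inequality hcov hK
  refine ⟨C, hC, fun α hα hαK ξ ζ hξ hζ => ?_⟩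
  obtain ⟨a, b, hab, hz⟩ := S.exists_norm_integral_herm_eq hξ hζ
  have hη : IsSmoothSectionAlong I F α fun z => a • ζ z + b • S.J (α z) (ζ z) :=
    contMDiff_lincomb_along hζ (S.contMDiff_J hζ) a b
  have hm := h α hα hαK ξ _ hξ hη
  have hDη : covDerivLoop cov α (fun z => a • ζ z + b • S.J (α z) (ζ z)) =
      fun θ => a • covDerivLoop cov α ζ θ + b • S.J _ (covDerivLoop cov α ζ θ) := by
    ext θ
    exact covDerivAlong_lincomb_J S (hζ.comp_exp.mdifferentiable (by simp) θ) a b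
  rw [hDη, S.normL2_lincomb hab,
    S.normL2_lincomb hab α (fun θ => ζ (Circle.exp θ))] at hm
  rw [hz]
  exact (le_abs_self _).trans hm

end Complex

end LoopBundle

end

theorem mainTheorem1
    -- the manifold `M`
    {EM : Type*} [NormedAddCommGroup EM] [NormedSpace ℝ EM] [FiniteDimensional ℝ EM]
    {HM : Type*} [TopologicalSpace HM] (I : ModelWithCorners ℝ EM HM) [I.Boundaryless]
    {M : Type*} [TopologicalSpace M] [ChartedSpace HM M] [IsManifold I ∞ M]
    [T2Space M] [SigmaCompactSpace M]
    -- the Riemannian metric `g` on `M`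
    [RiemannianBundle (fun x : M => TangentSpace I x)]
    [IsContMDiffRiemannianBundle I ∞ EM (fun x : M => TangentSpace I x)]
    -- the vector bundle `E` with its metric
    {F : Type*} [NormedAddCommGroup F] [NormedSpace ℝ F] [FiniteDimensional ℝ F]
    {E : M → Type*} [TopologicalSpace (TotalSpace F E)]
    [∀ x, NormedAddCommGroup (E x)] [∀ x, InnerProductSpace ℝ (E x)]
    [FiberBundle F E] [VectorBundle ℝ F E] [ContMDiffVectorBundle ∞ F E I]
    [IsContMDiffRiemannianBundle I ∞ F E]
    -- the smooth metric-compatible connection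
    (cov : CovariantDerivative I F E) [CovariantDerivative.ContMDiffCovariantDerivative cov ∞]
    (hcov : cov.IsMetricCompatible)
    (K : Set M) (hK : IsCompact K) :
    -- real bundles
    (∃ C : ℝ, 0 < C ∧
      ∀ α : Circle → M, ContMDiff (𝓡 1) I ∞ α → Set.range α ⊆ K →
      ∀ ξ ζ : ∀ z, E (α z),
        LoopBundle.IsSmoothSectionAlong I F α ξ → LoopBundle.IsSmoothSectionAlong I F α ζ →
        |∫ θ in (0 : ℝ)..(2 * Real.pi),
            inner ℝ (LoopBundle.covDerivLoop cov α ξ θ) (ζ (Circle.exp θ))| ≤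
          LoopBundle.normL2 α (LoopBundle.covDerivLoop cov α ξ) *
              LoopBundle.normL2 α (LoopBundle.covDerivLoop cov α ζ) +
            C * min (LoopBundle.speedL1 I α) (LoopBundle.speedL2 I α ^ 2) *
              LoopBundle.normW21 cov α ξ * LoopBundle.normL2 α (fun θ => ζ (Circle.exp θ))) ∧
    -- complex bundles
    (∀ S : LoopBundle.HermitianStructure cov, ∃ C : ℝ, 0 < C ∧
      ∀ α : Circle → M, ContMDiff (𝓡 1) I ∞ α → Set.range α ⊆ K →
      ∀ ξ ζ : ∀ z, E (α z),
        LoopBundle.IsSmoothSectionAlong I F α ξ → LoopBundle.IsSmoothSectionAlong I F α ζ →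
        ‖∫ θ in (0 : ℝ)..(2 * Real.pi),
            S.herm (α (Circle.exp θ)) (LoopBundle.covDerivLoop cov α ξ θ) (ζ (Circle.exp θ))‖ ≤
          LoopBundle.normL2 α (LoopBundle.covDerivLoop cov α ξ) *
              LoopBundle.normL2 α (LoopBundle.covDerivLoop cov α ζ) +
            C * min (LoopBundle.speedL1 I α) (LoopBundle.speedL2 I α ^ 2) *
              LoopBundle.normW21 cov α ξ * LoopBundle.normL2 α (fun θ => ζ (Circle.exp θ))) :=
  ⟨LoopBundle.loop_inequality hcov hK, fun S => LoopBundle.hermitian_loop_inequality hcov hK S⟩
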